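/- **Definitions.** *Relative graphs and semicategories.* A relative graph is a directed graph with a distinguished set of marked edges; $\mathsf{RelGraph}$ is the category of small relative graphs and marking-preserving graph morphisms. A relative semicategory is a small semicategory (a category without identities) with a set of marked morphisms closed under composition; with marking-preserving functors these form $\mathsf{RelSemiCat}$. The forgetful functor $\mathsf{U}^r:\mathsf{RelSemiCat}\to\mathsf{RelGraph}$ has a left adjoint $\mathsf{F}^r$, where $\mathsf{F}^rX$ has the vertices of $X$ as objects, the paths of length $\ge 1$ as morphisms, and the paths consisting of marked edges as marked morphisms. The free relative semicategory monad $\mathsf{f}^r$ is the induced monad on $\mathsf{RelGraph}$. *Fat Delta.* The category $\underline\Delta$ has as objects the epimorphisms $\eta:[m]\twoheadrightarrow[n]$ of the simplex category $\Delta$, and as morphisms the commutative squares in $\Delta$ between them whose top arrow $[m]\to[m']$ is a monomorphism. $\underline\Delta_0\subseteq\underline\Delta$ is the wide subcategory of the morphisms whose top arrow $f$ is distance preserving ($f(i+1)=f(i)+1$), $j:\underline\Delta_0\to\underline\Delta$ is the inclusion, and $i_0:\underline\Delta_0\to\mathsf{RelGraph}$ sends $\eta:[m]\twoheadrightarrow[n]$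 to the linear graph $0\to1\to\dots\to m$ in which the edges $i\to i+1$ with $\eta(i)=\eta(i+1)$ are marked. *Arities and theories.* Let $\mathcal E$ be a category. A fully faithful functor $i:\mathcal A\to\mathcal E$ from a small category is a dense generator if its nerve $\mathcal N_{\mathcal A}:\mathcal E\to\widehat{\mathcal A}$, $X\mapsto\mathcal E(i-,X)$, is fully faithful. A theory with arities $\mathcal A$ is a bijective-on-objects functor $j:\mathcal A\to\Theta$, where $\mathcal A$ is a dense generator, such that the monad $j^*j_!$ on $\widehat{\mathcal A}$ preserves the essential image of $\mathcal N_{\mathcal A}$. A morphism of $\Theta$ is free if it is in the image of $j$, and $g$ is generic if in every factorisation $g=j(f)\,g'$ the morphism $f$ is invertible in $\mathcal A$. The theory is homogeneous if $j$ is faithful and (generic, free) is an orthogonal factorisation system on $\Theta$. For a monad $T$ on $\mathcal E$, the category $\Theta_T$ and the functor $j_T:\mathcal A\to\Theta_T$ are obtained by factoring $\mathcal A\to\mathcal E\xrightarrow{F^T}\mathcal E^T$ into a bijective-on-objects functor $j_T$ followed by a fully faithful functor. If $\mathcal E$ has a terminal object $1$, the canonical arities of $T$ relative to a full subcategory $\mathscr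 A\subseteq\mathcal E$ are the objects isomorphic to some $L_1(p)$, where $p:A\to T1$ with $A\in\mathscr A$, and $L_1$ is the left adjoint of $T_1:\mathcal E\to\mathcal E/T1$, $X\mapsto T(X\to1)$. **Theorem 4.16.** Let $\mathscr A\subseteq\mathsf{RelGraph}$ consist of the finite nonempty linear graphs in which, of any two adjacent edges, exactly one is marked. The canonical arities of $\mathsf{f}^r$ relative to $\mathscr A$ are exactly the objects of the essential image of $i_0:\underline\Delta_0\to\mathsf{RelGraph}$. The theory $(\Theta_{\mathsf{f}^r},j_{\mathsf{f}^r})$ associated with $\mathsf{f}^r$ and the arities $i_0:\underline\Delta_0\to\mathsf{RelGraph}$ is a theory with arities $\underline\Delta_0$ and is homogeneous. It is fat Delta: there is an isomorphism of categories $\Phi:\Theta_{\mathsf{f}^r}\cong\underline\Delta$ with $\Phi\, j_{\mathsf{f}^r}=j$. Hence $(\underline\Delta,j)$ is a homogeneous theory with arities $\underline\Delta_0$; in particular the generic and the free morphisms form an orthogonal factorisation system on $\underline\Delta$. -/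

import Mathlib

open CategoryTheory Limits Opposite

universe u v v₁ v₂ v₃ u₁ u₂ u₃

/-! ### Relative graphs -/

/-- A relative graph: a directed graph (a set of vertices, a set of edges, sources and targets)
together with a wide subgraph, that is, a set of marked edges. -/
structure RelGraph where
  /-- vertices -/
  V : Type u
  /-- edges -/
  E : Type u
  /-- source -/
  src : E → V
  /-- target -/
  tgt : E → V
  /-- the edges of the wide subgraph -/
  marked : Set E

namespace RelGraph

/-- Morphisms of relative graphs: graph morphisms sending marked edges to marked edges. -/
@[ext]
structure Hom (G H : RelGraph.{u}) where
  /-- action on vertices -/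
  onV : G.V → H.V
  /-- action on edges -/
  onE : G.E → H.E
  src_onE : ∀ e, H.src (onE e) = onV (G.src e)
  tgt_onE : ∀ e, H.tgt (onE e) = onV (G.tgt e)
  marked_onE : ∀ e, e ∈ G.marked → onE e ∈ H.marked

instance : Category RelGraph.{u} where
  Hom := Hom
  id G :=
    { onV := id
      onE := id
      src_onE := fun _ => rfl
      tgt_onE := fun _ => rfl
      marked_onE := fun _ h => h }
  comp f g :=
    { onV := g.onV ∘ f.onV
      onE := g.onE ∘ f.onE
      src_onE := fun e => by simp [f.src_onE, g.src_onE]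
      tgt_onE := fun e => by simp [f.tgt_onE, g.tgt_onE]
      marked_onE := fun e h => g.marked_onE _ (f.marked_onE e h) }

theorem hom_ext {G H : RelGraph.{u}} {f g : G ⟶ H} (hV : ∀ x, f.onV x = g.onV x)
    (hE : ∀ e, f.onE e = g.onE e) : f = g :=
  Hom.ext (funext hV) (funext hE)

@[simp] theorem id_onV (G : RelGraph.{u}) (x : G.V) : Hom.onV (𝟙 G) x = x := rfl
@[simp] theorem id_onE (G : RelGraph.{u}) (e : G.E) : Hom.onE (𝟙 G) e = e := rfl
@[simp] theorem comp_onV {G H K : RelGraph.{u}} (f : G ⟶ H) (g : H ⟶ K) (x : G.V) :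
    (f ≫ g).onV x = g.onV (f.onV x) := rfl
@[simp] theorem comp_onE {G H K : RelGraph.{u}} (f : G ⟶ H) (g : H ⟶ K) (e : G.E) :
    (f ≫ g).onE e = g.onE (f.onE e) := rfl

/-- The terminal relative graph: one vertex and one marked loop. -/
def one : RelGraph.{u} where
  V := PUnit
  E := PUnit
  src _ := PUnit.unit
  tgt _ := PUnit.unit
  marked := Set.univ

/-- `RelGraph.one` is terminal. -/
def isTerminalOne : IsTerminal one.{u} :=
  IsTerminal.ofUniqueHom
    (fun _ =>
      { onV := fun _ => PUnit.unit
        onE := fun _ => PUnit.unit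
        src_onE := fun _ => rfl
        tgt_onE := fun _ => rfl
        marked_onE := fun _ _ => trivial })
    (fun _ _ => rfl)

/-- The linear graph `0 → 1 → ⋯ → n`, in which the edges belonging to `s` are marked. -/
def linear (n : ℕ) (s : Set (Fin n)) : RelGraph.{u} where
  V := ULift.{u} (Fin (n + 1))
  E := ULift.{u} (Fin n)
  src e := ⟨e.down.castSucc⟩
  tgt e := ⟨e.down.succ⟩
  marked := {e | e.down ∈ s}

/-- The alternatingly marked linear graphs: of any two adjacent edges exactly one is marked. -/
def alternating : ObjectProperty RelGraph.{u} := fun G =>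
  ∃ (n : ℕ) (s : Set (Fin n)),
    (∀ i j : Fin n, j.val = i.val + 1 → (i ∈ s ↔ j ∉ s)) ∧ G = linear n s

/-- Two edges are composable when the first one ends where the second one starts. -/
abbrev Composable (G : RelGraph.{u}) (a b : G.E) : Prop := G.tgt a = G.src b

/-- A (nonempty) path in a relative graph: a first edge followed by a list of further edges,
consecutive edges being composable. -/
@[ext]
structure Path (G : RelGraph.{u}) where
  /-- the first edge -/
  head : G.E
  /-- the remaining edges -/
  tail : List G.E
  chain : (head :: tail).IsChain G.Composable

namespace Path

variable {G H : RelGraph.{u}}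

/-- The list of all edges of a path. -/
def edges (p : Path G) : List G.E := p.head :: p.tail

theorem edges_ne (p : Path G) : p.edges ≠ [] := List.cons_ne_nil _ _

/-- Source of a path. -/
def src (p : Path G) : G.V := G.src p.head

/-- Target of a path. -/
def tgt (p : Path G) : G.V := G.tgt (p.edges.getLast p.edges_ne)

/-- The path of length one on an edge. -/
def single (e : G.E) : Path G := ⟨e, [], List.isChain_singleton e⟩

/-- Concatenation of paths. -/
def append (p q : Path G) (h : p.tgt = q.src) : Path G where
  head := p.head
  tail := p.tail ++ q.edges
  chain := by
    have : (p.edges ++ q.edges).IsChain G.Composable := by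
      rw [List.isChain_append]
      refine ⟨p.chain, q.chain, ?_⟩
      intro x hx y hy
      rw [List.getLast?_eq_getLast_of_ne_nil p.edges_ne] at hx
      simp only [edges, List.head?_cons, Option.mem_def, Option.some.injEq] at hx hy
      subst hx hy
      exact h
    exact this

/-- Image of a path under a morphism of relative graphs. -/
def map (f : G ⟶ H) (p : Path G) : Path H where
  head := f.onE p.head
  tail := p.tail.map f.onE
  chain := by
    have : ((p.head :: p.tail).map f.onE).IsChain H.Composable := by
      rw [List.isChain_map]
      exact p.chain.imp fun a b hab => by
        simp only [Composable] at hab ⊢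
        rw [f.tgt_onE, f.src_onE, hab]
    exact this

theorem tgt_map (f : G ⟶ H) (p : Path G) : (p.map f).tgt = f.onV p.tgt := by
  have h : (p.edges.map f.onE).getLast (by simp [edges]) = f.onE (p.edges.getLast p.edges_ne) := by
    rw [List.getLast_map]
  exact (congrArg H.tgt h).trans (f.tgt_onE _)

end Path

end RelGraph

/-! ### Relative semicategories -/

/-- A small relative semicategory: a graph with an associative composition of composable edges
(no identities), in which a wide subsemicategory, that is, a set of marked morphisms closed under
composition, is singled out. `C(x, y)` is the set of the `e : E` with `src e = x`, `tgt e = y`;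
composition is written in diagrammatic order. -/
structure RelSemiCat extends RelGraph.{u} where
  /-- composition: first `f`, then `g` -/
  comp : ∀ f g : E, tgt f = src g → E
  src_comp : ∀ f g h, src (comp f g h) = src f
  tgt_comp : ∀ f g h, tgt (comp f g h) = tgt g
  assoc : ∀ (f g k : E) (h₁ : tgt f = src g) (h₂ : tgt g = src k),
    comp (comp f g h₁) k ((tgt_comp f g h₁).trans h₂) =
      comp f (comp g k h₂) (h₁.trans (src_comp g k h₂).symm)
  marked_comp : ∀ f g h, f ∈ marked → g ∈ marked → comp f g h ∈ marked

namespace RelSemiCat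

/-- Functors of relative semicategories: they preserve composition and the marking. -/
structure Hom (C D : RelSemiCat.{u}) extends RelGraph.Hom C.toRelGraph D.toRelGraph where
  map_comp : ∀ (f g : C.E) (h : C.tgt f = C.src g),
    onE (C.comp f g h) =
      D.comp (onE f) (onE g) ((tgt_onE f).trans ((congrArg onV h).trans (src_onE g).symm))

theorem Hom.ext' {C D : RelSemiCat.{u}} {f g : Hom C D} (h : f.toHom = g.toHom) : f = g := by
  cases f; cases g; cases h; rfl

theorem comp_congr (C : RelSemiCat.{u}) {f f' g g' : C.E} (hf : f = f') (hg : g = g')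
    (h : C.tgt f = C.src g) : C.comp f g h = C.comp f' g' (hf ▸ hg ▸ h) := by
  subst hf hg; rfl

instance : Category RelSemiCat.{u} where
  Hom := Hom
  id C := { toHom := 𝟙 C.toRelGraph, map_comp := fun _ _ _ => rfl }
  comp {C D K} f g :=
    { toHom := (show C.toRelGraph ⟶ D.toRelGraph from f.toHom) ≫
        (show D.toRelGraph ⟶ K.toRelGraph from g.toHom)
      map_comp := fun a b h => by
        simp only [RelGraph.comp_onE]
        rw [f.map_comp, g.map_comp] }

/-- The forgetful functor `Uʳ` to relative graphs. -/
def forget : RelSemiCat.{u} ⥤ RelGraph.{u} where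
  obj C := C.toRelGraph
  map f := f.toHom

/-- The relative semicategory of paths in a relative graph: objects are the vertices, morphisms
the nonempty paths, composition is concatenation, and a path is marked when it is a path of the
wide subgraph of marked edges. -/
def pathSemiCat (G : RelGraph.{u}) : RelSemiCat.{u} where
  V := G.V
  E := G.Path
  src := RelGraph.Path.src
  tgt := RelGraph.Path.tgt
  marked := {p | ∀ e ∈ p.edges, e ∈ G.marked}
  comp := RelGraph.Path.append
  src_comp _ _ _ := rfl
  tgt_comp p q h := by
    simp only [RelGraph.Path.tgt]
    congr 1
    exact List.getLast_append_of_ne_nil (l := p.edges) _ q.edges_ne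
  assoc p q r h₁ h₂ := by
    ext1
    · rfl
    · exact List.append_assoc p.tail q.edges r.edges
  marked_comp p q h hp hq := by
    intro e he
    rcases List.mem_append.1 (show e ∈ p.edges ++ q.edges from he) with he | he
    · exact hp e he
    · exact hq e he

/-- The free functor `Fʳ`. -/
def free : RelGraph.{u} ⥤ RelSemiCat.{u} where
  obj := pathSemiCat
  map {G H} f :=
    { onV := f.onV
      onE := RelGraph.Path.map f
      src_onE := fun p => f.src_onE p.head
      tgt_onE := RelGraph.Path.tgt_map f
      marked_onE := fun p hp e he => by
        obtain ⟨a, ha, rfl⟩ := List.mem_map.1 (show e ∈ p.edges.map f.onE from he)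
        exact f.marked_onE a (hp a ha)
      map_comp := fun p q h => by
        apply RelGraph.Path.ext
        · rfl
        · exact List.map_append (f := f.onE) (l₁ := p.tail) (l₂ := q.edges) }
  map_id G := by
    apply Hom.ext'
    apply RelGraph.hom_ext
    · intro x; rfl
    · intro p
      apply RelGraph.Path.ext
      · rfl
      · exact List.map_id p.tail
  map_comp f g := by
    apply Hom.ext'
    apply RelGraph.hom_ext
    · intro x; rfl
    · intro p
      apply RelGraph.Path.ext
      · rfl
      · exact (List.map_map (f := f.onE) (g := g.onE) (l := p.tail)).symm

/-- The composite of a composable list `e, l₁, …, lₖ` of morphisms. -/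
def composeAux (C : RelSemiCat.{u}) : (e : C.E) → (l : List C.E) →
    (e :: l).IsChain C.Composable →
    {x : C.E // C.src x = C.src e ∧ C.tgt x = C.tgt ((e :: l).getLast (List.cons_ne_nil e l))}
  | e, [], _ => ⟨e, rfl, rfl⟩
  | e, f :: l, h =>
    let r := composeAux C f l (List.isChain_cons_cons.1 h).2
    have hr : C.tgt e = C.src r.1 := (List.isChain_cons_cons.1 h).1.trans r.2.1.symm
    ⟨C.comp e r.1 hr, C.src_comp _ _ _, (C.tgt_comp _ _ _).trans r.2.2⟩

/-- The composite of a path of morphisms in a relative semicategory. -/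
def compose (C : RelSemiCat.{u}) (p : C.toRelGraph.Path) : C.E :=
  (composeAux C p.head p.tail p.chain).1

theorem src_compose (C : RelSemiCat.{u}) (p : C.toRelGraph.Path) :
    C.src (C.compose p) = p.src := (composeAux C p.head p.tail p.chain).2.1

theorem tgt_compose (C : RelSemiCat.{u}) (p : C.toRelGraph.Path) :
    C.tgt (C.compose p) = p.tgt := (composeAux C p.head p.tail p.chain).2.2

theorem composeAux_marked (C : RelSemiCat.{u}) : ∀ (e : C.E) (l : List C.E)
    (h : (e :: l).IsChain C.Composable), (∀ x ∈ e :: l, x ∈ C.marked) →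
      (composeAux C e l h).1 ∈ C.marked
  | e, [], _, hm => hm e (by simp)
  | e, f :: l, _, hm =>
    C.marked_comp _ _ _ (hm e (by simp))
      (composeAux_marked C f l _ fun x hx => hm x (List.mem_cons_of_mem _ hx))

theorem composeAux_append (C : RelSemiCat.{u}) (q : C.toRelGraph.Path) :
    ∀ (e : C.E) (l : List C.E) (h : (e :: l).IsChain C.Composable)
      (h' : (e :: (l ++ q.edges)).IsChain C.Composable)
      (h'' : C.tgt (composeAux C e l h).1 = C.src (C.compose q)),
      (composeAux C e (l ++ q.edges) h').1 = C.comp (composeAux C e l h).1 (C.compose q) h''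
  | e, [], _, _, _ => rfl
  | e, f :: l, h, h', h'' => by
    have h₂ := (List.isChain_cons_cons.1 h).2
    have h₂' : (f :: (l ++ q.edges)).IsChain C.Composable := (List.isChain_cons_cons.1 h').2
    have h₃ : C.tgt (composeAux C f l h₂).1 = C.src (C.compose q) :=
      (C.tgt_comp _ _ _).symm.trans h''
    have ih := composeAux_append C q f l h₂ h₂' h₃
    refine Eq.trans ?_ (C.assoc e (composeAux C f l h₂).1 (C.compose q) _ h₃).symm
    exact C.comp_congr rfl ih _

theorem compose_append (C : RelSemiCat.{u}) (p q : C.toRelGraph.Path) (h : p.tgt = q.src) :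
    C.compose (p.append q h) =
      C.comp (C.compose p) (C.compose q) ((C.tgt_compose p).trans (h.trans (C.src_compose q).symm)) :=
  composeAux_append C q p.head p.tail p.chain _ _

theorem composeAux_map {C D : RelSemiCat.{u}} (f : C ⟶ D) : ∀ (e : C.E) (l : List C.E)
    (h : (e :: l).IsChain C.Composable)
    (h' : (f.onE e :: l.map f.onE).IsChain D.Composable),
      f.onE (composeAux C e l h).1 = (composeAux D (f.onE e) (l.map f.onE) h').1
  | e, [], _, _ => rfl
  | e, a :: l, h, h' => by
    have ih := composeAux_map f a l (List.isChain_cons_cons.1 h).2 (List.isChain_cons_cons.1 h').2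
    exact (f.map_comp _ _ _).trans (D.comp_congr rfl ih _)

theorem compose_single_edges (G : RelGraph.{u}) : ∀ (e : G.E) (l : List G.E)
    (h : (e :: l).IsChain G.Composable)
    (h' : ((RelGraph.Path.single e : G.Path) :: l.map RelGraph.Path.single).IsChain
      (pathSemiCat G).Composable),
      (composeAux (pathSemiCat G) (RelGraph.Path.single e) (l.map RelGraph.Path.single) h').1 =
        ⟨e, l, h⟩
  | e, [], _, _ => rfl
  | e, a :: l, h, h' => by
    have ih := compose_single_edges G a l (List.isChain_cons_cons.1 h).2
      (List.isChain_cons_cons.1 h').2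
    exact (pathSemiCat G).comp_congr rfl ih
      ((List.isChain_cons_cons.1 h').1.trans
        (composeAux (pathSemiCat G) (RelGraph.Path.single a) (l.map RelGraph.Path.single)
          (List.isChain_cons_cons.1 h').2).2.1.symm)

/-- The unit: an edge is sent to the path of length one. -/
def unitHom (G : RelGraph.{u}) : G ⟶ (pathSemiCat G).toRelGraph where
  onV x := x
  onE := RelGraph.Path.single
  src_onE _ := rfl
  tgt_onE _ := rfl
  marked_onE e he := by
    intro x hx
    have : x = e := List.mem_singleton.1 hx
    exact this ▸ he

/-- The counit: a path of morphisms is sent to its composite. -/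
def counitHom (C : RelSemiCat.{u}) : pathSemiCat C.toRelGraph ⟶ C where
  onV x := x
  onE := C.compose
  src_onE p := C.src_compose p
  tgt_onE p := C.tgt_compose p
  marked_onE p hp := composeAux_marked C p.head p.tail p.chain hp
  map_comp p q h := C.compose_append p q h

/-- The free-forgetful adjunction `Fʳ ⊣ Uʳ`. -/
def adj : free.{u} ⊣ forget.{u} where
  unit := { app := unitHom, naturality := fun _ _ _ => rfl }
  counit :=
    { app := counitHom
      naturality := fun C D f => by
        apply Hom.ext'
        apply RelGraph.hom_ext
        · intro x; rfl
        · intro p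
          exact (composeAux_map f p.head p.tail p.chain _).symm }
  left_triangle_components G := by
    apply Hom.ext'
    apply RelGraph.hom_ext
    · intro x; rfl
    · intro p
      exact compose_single_edges G p.head p.tail p.chain _
  right_triangle_components C := by
    apply RelGraph.hom_ext
    · intro x; rfl
    · intro e; rfl

end RelSemiCat

/-- The free relative semicategory monad `fʳ`, induced by the adjunction `Fʳ ⊣ Uʳ`. -/
def relSemiCatMonad : Monad RelGraph.{u} := RelSemiCat.adj.{u}.toMonad

/-! ### Orthogonal factorisation systems, monads with arities, theories -/

/-- `(L, R)` is an orthogonal factorisation system. -/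
structure IsOrthogonalFactorizationSystem {C : Type u₁} [Category.{v₁} C]
    (L R : MorphismProperty C) : Prop where
  isos_le_left : MorphismProperty.isomorphisms C ≤ L
  isos_le_right : MorphismProperty.isomorphisms C ≤ R
  comp_left : L.IsStableUnderComposition
  comp_right : R.IsStableUnderComposition
  factorization : ∀ {X Y : C} (f : X ⟶ Y),
    ∃ (Z : C) (l : X ⟶ Z) (r : Z ⟶ Y), L l ∧ R r ∧ l ≫ r = f
  orthogonal : ∀ {A B X Y : C} (l : A ⟶ B) (r : X ⟶ Y) (s : A ⟶ X) (t : B ⟶ Y),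
    L l → R r → s ≫ r = l ≫ t → ∃! d : B ⟶ X, l ≫ d = s ∧ d ≫ r = t

/-- The nerve functor `E ⥤ PSh(A)`, `X ↦ E(i -, X)`, of a functor `i : A ⥤ E`. -/
def nerveAlong {A : Type u₁} [Category.{v₁} A] {E : Type u₂} [Category.{v₂} E] (i : A ⥤ E) :
    E ⥤ (Aᵒᵖ ⥤ Type v₂) :=
  yoneda ⋙ (Functor.whiskeringLeft Aᵒᵖ Eᵒᵖ (Type v₂)).obj i.op

/-- `i` exhibits `A` as a dense full subcategory of `E`: both `i` and its nerve functor are fully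
faithful. (Smallness of `A` is a matter of universe levels.) -/
structure IsDenseGenerator {A : Type u₁} [Category.{v₁} A] {E : Type u₂} [Category.{v₂} E]
    (i : A ⥤ E) : Prop where
  full : i.Full
  faithful : i.Faithful
  nerve_full : (nerveAlong i).Full
  nerve_faithful : (nerveAlong i).Faithful

/-- For an endofunctor `T` of a category with a terminal object `o`, the functor
`T₁ : E ⥤ E / T o` sending `X` to `T (X ⟶ o)`. -/
def toOverTerminal {E : Type u₁} [Category.{v₁} E] (T : E ⥤ E) {o : E} (ho : IsTerminal o) :
    E ⥤ Over (T.obj o) where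
  obj X := Over.mk (T.map (ho.from X))
  map f := Over.homMk (T.map f) (by simp [← T.map_comp])

/-- The canonical arities of `T` relative to a full subcategory `𝒜` of `E`: the essential image of
`𝒜 / T 1 → E / T 1 → E`, where the second functor is the left adjoint of `T₁`. The value of that
left adjoint at `p : A ⟶ T 1` is expressed as an initial object of the comma category `p ↓ T₁`. -/
def canonicalArities {E : Type u₁} [Category.{v₁} E] (T : E ⥤ E) {o : E} (ho : IsTerminal o)
    (𝒜 : ObjectProperty E) : ObjectProperty E := fun X =>
  ∃ (A : E) (_ : 𝒜 A) (p : A ⟶ T.obj o)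
    (L : StructuredArrow (Over.mk p) (toOverTerminal T ho)),
    Nonempty (IsInitial L) ∧ Nonempty (L.right ≅ X)

/-- The category `Θ_T`: in the factorisation of `A ⥤ E ⥤ T-Alg` into a bijective-on-objects
functor followed by a fully faithful one, the middle category. Its objects are those of `A`, its
morphisms `a ⟶ b` are the morphisms of the free algebras on `i a` and `i b`. -/
abbrev MonadTheory {A : Type u₁} [Category.{v₁} A] {E : Type u₂} [Category.{v₂} E]
    (T : Monad E) (i : A ⥤ E) : Type u₁ :=
  InducedCategory T.Algebra fun a : A => T.free.obj (i.obj a)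

/-- The bijective-on-objects functor `j_T : A ⥤ Θ_T`. -/
def MonadTheory.j {A : Type u₁} [Category.{v₁} A] {E : Type u₂} [Category.{v₂} E]
    (T : Monad E) (i : A ⥤ E) : A ⥤ MonadTheory T i where
  obj a := a
  map f := InducedCategory.homMk (T.free.map (i.map f))

/-- `j : A ⥤ Θ` is a theory with arities `i : A ⥤ E`: `i` is a dense generator, `j` is bijective on
objects, and the monad `j^* j_!` on presheaves on `A` preserves the essential image of the nerve
functor of `i`, where `j_!` is left Kan extension along `jᵒᵖ`. -/
structure IsTheoryWithArities {A : Type u₁} [Category.{v₁} A] {E : Type u₂} [Category.{v₂} E]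
    {Θ : Type u₃} [Category.{v₃} Θ] (i : A ⥤ E) (j : A ⥤ Θ) : Prop where
  dense : IsDenseGenerator i
  bijective_obj : Function.Bijective j.obj
  preserves : ∀ P : Aᵒᵖ ⥤ Type v₂, (nerveAlong i).essImage P →
    ∃ (Q : Θᵒᵖ ⥤ Type v₂) (α : P ⟶ j.op ⋙ Q),
      Q.IsLeftKanExtension α ∧ (nerveAlong i).essImage (j.op ⋙ Q)

/-- Free morphisms: those in the image of `j`. -/
def freeMorphisms {A : Type u₁} [Category.{v₁} A] {Θ : Type u₃} [Category.{v₃} Θ] (j : A ⥤ Θ) :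
    MorphismProperty Θ :=
  (⊤ : MorphismProperty A).strictMap j

/-- Generic morphisms: whenever `g = j(f) ∘ g'`, the morphism `f` is invertible in `A`. -/
def genericMorphisms {A : Type u₁} [Category.{v₁} A] {Θ : Type u₃} [Category.{v₃} Θ] (j : A ⥤ Θ) :
    MorphismProperty Θ := fun X Y g =>
  ∀ ⦃a b : A⦄ (f : a ⟶ b) (g' : X ⟶ j.obj a) (h : j.obj b = Y),
    g = g' ≫ j.map f ≫ eqToHom h → IsIso f

/-- A theory with arities `j : A ⥤ Θ` is homogeneous: `j` is faithful, and the generic and the free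
morphisms form an orthogonal factorisation system on `Θ`. -/
structure IsHomogeneousTheory {A : Type u₁} [Category.{v₁} A] {E : Type u₂} [Category.{v₂} E]
    {Θ : Type u₃} [Category.{v₃} Θ] (i : A ⥤ E) (j : A ⥤ Θ) : Prop where
  theory : IsTheoryWithArities i j
  faithful : j.Faithful
  genericFree : IsOrthogonalFactorizationSystem (genericMorphisms j) (freeMorphisms j)

/-! ### Fat Delta -/

/-- Objects of fat Delta: epimorphisms `η : [m] ↠ [n]` of the simplex category. -/
structure FatDelta where
  /-- `[m]` -/
  dom : SimplexCategory
  /-- `[n]` -/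
  cod : SimplexCategory
  /-- the epimorphism -/
  η : dom ⟶ cod
  epi : Epi η

namespace FatDelta

/-- Morphisms of fat Delta: commutative squares whose top arrow is a monomorphism. -/
@[ext]
structure Hom (X Y : FatDelta) where
  /-- the top arrow -/
  top : X.dom ⟶ Y.dom
  /-- the bottom arrow -/
  bot : X.cod ⟶ Y.cod
  mono : Mono top
  w : top ≫ Y.η = X.η ≫ bot

instance : Category FatDelta where
  Hom := Hom
  id X := { top := 𝟙 _, bot := 𝟙 _, mono := inferInstance, w := by simp }
  comp f g :=
    { top := f.top ≫ g.top
      bot := f.bot ≫ g.bot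
      mono := by
        have := f.mono
        have := g.mono
        exact mono_comp _ _
      w := by rw [Category.assoc, g.w, ← Category.assoc, f.w, Category.assoc] }

@[simp] theorem id_top (X : FatDelta) : Hom.top (𝟙 X) = 𝟙 X.dom := rfl
@[simp] theorem comp_top {X Y Z : FatDelta} (f : X ⟶ Y) (g : Y ⟶ Z) :
    (f ≫ g).top = f.top ≫ g.top := rfl

/-- A morphism of fat Delta is inert when its top arrow is inert in the simplex category, that is,
distance preserving. -/
def inert : MorphismProperty FatDelta := fun X _ f =>
  ∀ i : Fin X.dom.len,
    (f.top.toOrderHom i.succ).val = (f.top.toOrderHom i.castSucc).val + 1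

theorem inert_add {X Y : FatDelta} (f : X ⟶ Y) (hf : inert f) (i : Fin (X.dom.len + 1)) :
    (f.top.toOrderHom i).val = (f.top.toOrderHom 0).val + i.val := by
  induction i using Fin.induction with
  | zero => simp
  | succ i ih => rw [hf i, ih]; simp [Nat.add_assoc]

instance : inert.IsMultiplicative where
  id_mem X := by intro i; simp
  comp_mem {X Y Z} f g hf hg := by
    intro i
    simp only [comp_top, SimplexCategory.comp_toOrderHom, OrderHom.comp_coe, Function.comp_apply]
    rw [inert_add g hg (f.top.toOrderHom i.succ), inert_add g hg (f.top.toOrderHom i.castSucc),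
      hf i]
    omega

/-- The wide subcategory of fat Delta on the inert morphisms. -/
abbrev Inert : Type := WideSubcategory inert

/-- The identity-on-objects inclusion of the inert part into fat Delta. -/
abbrev inertInclusion : Inert ⥤ FatDelta := wideSubcategoryInclusion inert

/-- The marked edges of the linear graph on `[m]` determined by `η : [m] ↠ [n]`: those that `η`
collapses to a point. -/
def markedEdges (X : FatDelta) : Set (Fin X.dom.len) :=
  {i | X.η.toOrderHom i.castSucc = X.η.toOrderHom i.succ}

/-- The action on edges of an inert morphism. -/
def edgeMap {X Y : FatDelta} (f : X ⟶ Y) (hf : inert f) (i : Fin X.dom.len) : Fin Y.dom.len :=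
  ⟨(f.top.toOrderHom i.castSucc).val, by
    have h₁ := hf i
    have h₂ := (f.top.toOrderHom i.succ).isLt
    omega⟩

theorem castSucc_edgeMap {X Y : FatDelta} (f : X ⟶ Y) (hf : inert f) (i : Fin X.dom.len) :
    (edgeMap f hf i).castSucc = f.top.toOrderHom i.castSucc := rfl

theorem succ_edgeMap {X Y : FatDelta} (f : X ⟶ Y) (hf : inert f) (i : Fin X.dom.len) :
    (edgeMap f hf i).succ = f.top.toOrderHom i.succ := Fin.ext (hf i).symm

theorem w_apply {X Y : FatDelta} (f : X ⟶ Y) (i : Fin (X.dom.len + 1)) :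
    Y.η.toOrderHom (f.top.toOrderHom i) = f.bot.toOrderHom (X.η.toOrderHom i) :=
  SimplexCategory.congr_toOrderHom_apply f.w i

/-- The inclusion `i₀` of the inert part of fat Delta into relative graphs: `η : [m] ↠ [n]` is sent
to the linear graph on `[m]` in which the edges collapsed by `η` are marked. -/
def toRelGraph : Inert ⥤ RelGraph.{u} where
  obj X := RelGraph.linear X.obj.dom.len X.obj.markedEdges
  map {X Y} f :=
    { onV := fun x => ⟨f.hom.top.toOrderHom x.down⟩
      onE := fun e => ⟨edgeMap f.hom f.property e.down⟩
      src_onE := fun _ => rfl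
      tgt_onE := fun e => ULift.ext _ _ (succ_edgeMap f.hom f.property e.down)
      marked_onE := fun e he => by
        change Y.obj.η.toOrderHom (edgeMap f.hom f.property e.down).castSucc =
          Y.obj.η.toOrderHom (edgeMap f.hom f.property e.down).succ
        rw [castSucc_edgeMap, succ_edgeMap, w_apply, w_apply]
        exact congrArg _ he }
  map_id X := rfl
  map_comp f g := rfl

end FatDelta

/-! ### Combinatorics of fat Delta -/

/-! Since `η` is epi, a morphism of fat Delta is determined by its top arrow. A strictly monotone
map of vertices is a top arrow exactly when it sends each marked edge to an interval consisting of
marked edges (`exists_hom`). On the other side, a morphism of free algebras between linear graphs is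
a Kleisli map, which sends each edge to a nonempty path, and a marked edge to a path of marked
edges. A path in a linear graph is an interval, determined by its endpoints, so this is the same
data. Hence the theory of the monad is fat Delta (`toFatDelta_map_bijective`).

The other claims rest on covering morphisms `g : X ⟶ Y`: the endpoints are preserved, and every
marked edge of `Y` lies below a marked edge of `X`. Inert morphisms are translations. Every morphism
factors as a covering one followed by an inert one, covering morphisms lift uniquely against inert
ones, and covering means generic (`genericMorphisms_iff_covering`). This is the factorisation
system.

Covering morphisms also have a universal property (`Covering.exists_map`, `Covering.map_unique`):
maps `Y.graph ⟶ Z` correspond to maps from `X.graph` to the paths of `Z` whose path lengths are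
those prescribed by `g`. Every map from `X.graph` to paths has the lengths of some covering
morphism, so it has an initial factorisation through an arity. Therefore the left Kan extension of
the nerve of `Z` restricts to the nerve of `T Z`, which is the condition on arities. A map from
`X.graph` to the paths of the terminal graph records lengths only, so the same property computes
`L₁` as `Y.graph`. Every `Y` is reached from an alternating graph by contracting its maximal runs of
equally marked edges; this gives the canonical arities. -/

theorem Fin.exists_block {m n : ℕ} (t : Fin (m + 1) → Fin (n + 1)) (h0 : t 0 = 0)
    (hl : t (Fin.last m) = Fin.last n) (e : Fin n) :
    ∃ e' : Fin m, t e'.castSucc ≤ e.castSucc ∧ e.succ ≤ t e'.succ := by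
  -- A discrete intermediate value argument: descend from `i` to a step at which `t` crosses the
  -- edge `e`.
  have key : ∀ i : Fin (m + 1), e.succ ≤ t i →
      ∃ e' : Fin m, t e'.castSucc ≤ e.castSucc ∧ e.succ ≤ t e'.succ := by
    intro i
    induction i using Fin.induction with
    | zero =>
      intro h
      rw [h0] at h
      exact absurd h (by simp)
    | succ i ih =>
      intro h
      by_cases hc : e.succ ≤ t i.castSucc
      · exact ih hc
      · exact ⟨i, by
          simp only [Fin.le_def, Fin.val_succ, Fin.val_castSucc] at hc ⊢
          omega, h⟩
  exact key (Fin.last m) (by rw [hl]; exact Fin.le_last _)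

/-- Applied with `f = η`: an interval all of whose edges are marked is collapsed to a point.
`Monotone.eq_of_between` gives the converse. -/
theorem Fin.eq_of_adjacent {n : ℕ} {α : Type*} {f : Fin (n + 1) → α}
    {a b : Fin (n + 1)} (hab : a ≤ b)
    (h : ∀ e : Fin n, a ≤ e.castSucc → e.succ ≤ b → f e.castSucc = f e.succ) : f a = f b := by
  induction b using Fin.induction with
  | zero => rw [Fin.le_zero_iff.1 hab]
  | succ b ih =>
    rcases hab.eq_or_lt with rfl | hlt
    · rfl
    · have hb : a ≤ b.castSucc := by
        simp only [Fin.le_def, Fin.lt_def, Fin.val_succ, Fin.val_castSucc] at hlt ⊢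
        omega
      rw [ih hb fun e h₁ h₂ => h e h₁ (h₂.trans (Fin.castSucc_lt_succ).le), h b hb le_rfl]

theorem Monotone.eq_of_between {α β : Type*} [Preorder α] [PartialOrder β] {f : α → β}
    (hf : Monotone f) {a b c d : α} (hab : a ≤ b) (hbc : b ≤ c) (hcd : c ≤ d) (h : f a = f d) :
    f b = f c :=
  le_antisymm (hf hbc) ((hf hcd).trans (h.symm.le.trans (hf hab)))

/-- Injectivity on objects removes the transport `eqToHom` from the definition. -/
theorem genericMorphisms_obj_iff {A : Type u₁} [Category.{v₁} A] {Θ : Type u₂} [Category.{v₂} Θ]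
    {j : A ⥤ Θ} (hj : Function.Injective j.obj) {X : Θ} {b : A} (g : X ⟶ j.obj b) :
    genericMorphisms j g ↔
      ∀ (a : A) (f : a ⟶ b) (g' : X ⟶ j.obj a), g' ≫ j.map f = g → IsIso f := by
  constructor
  · intro h a f g' hg
    exact h f g' rfl (by simpa using hg.symm)
  · intro h a b' f g' hb hg
    obtain rfl := hj hb
    exact h a f g' (by simpa using hg.symm)

namespace FatDelta

/-! ### Morphisms of fat Delta described by their top arrows. -/

theorem strictMono_top {X Y : FatDelta} (f : X ⟶ Y) : StrictMono f.top.toOrderHom :=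
  f.top.toOrderHom.monotone.strictMono_of_injective (SimplexCategory.mono_iff_injective.1 f.mono)

theorem surjective_η (X : FatDelta) : Function.Surjective X.η.toOrderHom :=
  SimplexCategory.epi_iff_surjective.1 X.epi

theorem hom_ext {X Y : FatDelta} {f g : X ⟶ Y}
    (h : ∀ i, f.top.toOrderHom i = g.top.toOrderHom i) : f = g := by
  have ht : f.top = g.top := SimplexCategory.Hom.ext _ _ (OrderHom.ext _ _ (funext h))
  have := X.epi
  refine Hom.ext ht ?_
  rw [← cancel_epi X.η, ← f.w, ← g.w, ht]

/-- A morphism of fat Delta is the same thing as a strictly monotone map carrying marked edges to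
intervals that are collapsed. -/
theorem exists_hom {X Y : FatDelta} (t : Fin (X.dom.len + 1) → Fin (Y.dom.len + 1))
    (ht : StrictMono t)
    (hm : ∀ e ∈ X.markedEdges, Y.η.toOrderHom (t e.castSucc) = Y.η.toOrderHom (t e.succ)) :
    ∃ f : X ⟶ Y, ∀ i, f.top.toOrderHom i = t i := by
  have key : ∀ i j, i ≤ j → X.η.toOrderHom i = X.η.toOrderHom j →
      Y.η.toOrderHom (t i) = Y.η.toOrderHom (t j) := by
    intro i j hij h
    refine Fin.eq_of_adjacent (f := fun k => Y.η.toOrderHom (t k)) hij fun e h₁ h₂ => hm e ?_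
    exact X.η.toOrderHom.monotone.eq_of_between h₁ (Fin.castSucc_lt_succ).le h₂ h
  have key' : ∀ i j, X.η.toOrderHom i = X.η.toOrderHom j →
      Y.η.toOrderHom (t i) = Y.η.toOrderHom (t j) := fun i j h =>
    (le_total i j).elim (fun hij => key i j hij h) fun hij => (key j i hij h.symm).symm
  -- The bottom arrow is read off along a section `σ` of `X.η`, which is monotone because `X.η` is.
  -- By `key'` the square commutes whichever section is chosen.
  choose σ hσ using X.surjective_η
  let b : Fin (X.cod.len + 1) →o Fin (Y.cod.len + 1) :=
    { toFun := fun k => Y.η.toOrderHom (t (σ k))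
      monotone' := by
        intro k l hkl
        rcases hkl.eq_or_lt with rfl | hlt
        · exact le_rfl
        · refine Y.η.toOrderHom.monotone (ht.monotone (le_of_not_ge fun hge => ?_))
          have := X.η.toOrderHom.monotone hge
          rw [hσ, hσ] at this
          exact absurd hlt this.not_gt }
  refine ⟨{ top := SimplexCategory.Hom.mk ⟨t, ht.monotone⟩
            bot := SimplexCategory.Hom.mk b
            mono := SimplexCategory.mono_iff_injective.2 ht.injective
            w := ?_ }, fun i => rfl⟩
  refine SimplexCategory.Hom.ext _ _ (OrderHom.ext _ _ (funext fun i => ?_))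
  exact key' _ _ (hσ _).symm

theorem η_eq_of_mem_markedEdges {X Y : FatDelta} (f : X ⟶ Y) {e : Fin X.dom.len}
    (he : e ∈ X.markedEdges) :
    Y.η.toOrderHom (f.top.toOrderHom e.castSucc) = Y.η.toOrderHom (f.top.toOrderHom e.succ) := by
  rw [w_apply, w_apply]
  exact congrArg _ he

/-! ### Objects of fat Delta with prescribed marked edges. -/

theorem exists_count_eq (p : ℕ → Prop) [DecidablePred p] (n y : ℕ) (hy : y ≤ Nat.count p n) :
    ∃ i ≤ n, Nat.count p i = y := by
  induction n with
  | zero => exact ⟨0, le_rfl, by simpa using hy.antisymm' (Nat.zero_le _)⟩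
  | succ n ih =>
    by_cases h : y ≤ Nat.count p n
    · obtain ⟨i, hi, rfl⟩ := ih h
      exact ⟨i, hi.trans (Nat.le_succ n), rfl⟩
    · refine ⟨n + 1, le_rfl, ?_⟩
      rw [Nat.count_succ] at hy ⊢
      split_ifs at hy ⊢ <;> omega

/-- Let `η` send a vertex to the number of unmarked edges before it: it is constant along an edge
exactly when that edge is marked. It is surjective because a count grows by at most one at each
step. -/
theorem exists_markedEdges_eq (n : ℕ) (s : Set (Fin n)) :
    ∃ (k : ℕ) (η : SimplexCategory.mk n ⟶ SimplexCategory.mk k), Epi η ∧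
      ∀ e : Fin n, η.toOrderHom e.castSucc = η.toOrderHom e.succ ↔ e ∈ s := by
  classical
  -- For `k ≥ n` this holds vacuously, but only the values `k < n` are ever counted.
  let p : ℕ → Prop := fun k => ∀ h : k < n, (⟨k, h⟩ : Fin n) ∉ s
  let c : Fin (n + 1) →o Fin (Nat.count p n + 1) :=
    { toFun := fun i => ⟨Nat.count p i.val,
        Nat.lt_succ_of_le (Nat.count_monotone p (Nat.le_of_lt_succ i.isLt))⟩
      monotone' := fun i j hij => Nat.count_monotone p hij }
  refine ⟨Nat.count p n, SimplexCategory.Hom.mk c, ?_, ?_⟩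
  · refine SimplexCategory.epi_iff_surjective.2 fun y => ?_
    obtain ⟨i, hi, h⟩ := exists_count_eq p n y.val (Nat.le_of_lt_succ y.isLt)
    exact ⟨⟨i, Nat.lt_succ_of_le hi⟩, Fin.ext h⟩
  · intro e
    change c e.castSucc = c e.succ ↔ _
    rw [Fin.ext_iff]
    change Nat.count p e.val = Nat.count p (e.val + 1) ↔ _
    rw [Nat.count_succ]
    have hp : p e.val ↔ e ∉ s := ⟨fun h => h e.isLt, fun h _ => h⟩
    by_cases he : e ∈ s <;> simp [hp, he]

/-- The object of fat Delta on `[n]` in which exactly the edges belonging to `s` are marked. -/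
noncomputable def ofMarks (n : ℕ) (s : Set (Fin n)) : FatDelta where
  dom := SimplexCategory.mk n
  cod := SimplexCategory.mk (exists_markedEdges_eq n s).choose
  η := (exists_markedEdges_eq n s).choose_spec.choose
  epi := (exists_markedEdges_eq n s).choose_spec.choose_spec.1

theorem markedEdges_ofMarks (n : ℕ) (s : Set (Fin n)) : (ofMarks n s).markedEdges = s :=
  Set.ext (exists_markedEdges_eq n s).choose_spec.choose_spec.2

/-- A morphism of fat Delta is covering when its top arrow preserves the endpoints and every marked
edge of the target lies below a marked edge of the source. -/
structure Covering {X Y : FatDelta} (g : X ⟶ Y) : Prop where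
  zero : g.top.toOrderHom 0 = 0
  last : g.top.toOrderHom (Fin.last _) = Fin.last _
  marked : ∀ e ∈ Y.markedEdges, ∃ e' ∈ X.markedEdges,
    g.top.toOrderHom e'.castSucc ≤ e.castSucc ∧ e.succ ≤ g.top.toOrderHom e'.succ

/-! ### Covering morphisms: isomorphisms, factorisation and lifting. -/

theorem Covering.comp {X Y Z : FatDelta} {g : X ⟶ Y} {h : Y ⟶ Z} (hg : Covering g)
    (hh : Covering h) : Covering (g ≫ h) where
  zero := by
    change h.top.toOrderHom (g.top.toOrderHom 0) = 0
    rw [hg.zero, hh.zero]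
  last := by
    change h.top.toOrderHom (g.top.toOrderHom (Fin.last _)) = _
    rw [hg.last, hh.last]
  marked e he := by
    obtain ⟨e₁, he₁, h₁, h₂⟩ := hh.marked e he
    obtain ⟨e₂, he₂, h₃, h₄⟩ := hg.marked e₁ he₁
    exact ⟨e₂, he₂, (h.top.toOrderHom.monotone h₃).trans h₁, h₂.trans (h.top.toOrderHom.monotone h₄)⟩

theorem top_inv_top {X Y : FatDelta} (g : X ⟶ Y) [IsIso g] (i : Fin (Y.dom.len + 1)) :
    g.top.toOrderHom ((inv g).top.toOrderHom i) = i := by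
  change ((inv g) ≫ g).top.toOrderHom i = i
  rw [IsIso.inv_hom_id]
  rfl

theorem inv_top_top {X Y : FatDelta} (g : X ⟶ Y) [IsIso g] (i : Fin (X.dom.len + 1)) :
    (inv g).top.toOrderHom (g.top.toOrderHom i) = i := by
  change (g ≫ (inv g)).top.toOrderHom i = i
  rw [IsIso.hom_inv_id]
  rfl

/-- If the images of adjacent vertices left a gap, the inverse would send a vertex of the gap
strictly between two adjacent vertices. -/
theorem inert_of_isIso {X Y : FatDelta} (g : X ⟶ Y) [IsIso g] : inert g := by
  intro i
  have h := strictMono_top g (Fin.castSucc_lt_succ (i := i))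
  by_contra hne
  let k : Fin (Y.dom.len + 1) := ⟨(g.top.toOrderHom i.castSucc).val + 1, by
    have := (g.top.toOrderHom i.succ).isLt
    rw [Fin.lt_def] at h
    omega⟩
  have h₁ : g.top.toOrderHom i.castSucc < k := by simp [k, Fin.lt_def]
  have h₂ : k < g.top.toOrderHom i.succ := by
    simp only [Fin.lt_def, k] at h ⊢
    omega
  have h₃ := strictMono_top (inv g) h₁
  have h₄ := strictMono_top (inv g) h₂
  rw [inv_top_top] at h₃ h₄
  simp only [Fin.lt_def, Fin.val_succ, Fin.val_castSucc] at h₃ h₄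
  omega

theorem covering_of_isIso {X Y : FatDelta} (g : X ⟶ Y) [IsIso g] : Covering g where
  zero := by
    have := g.top.toOrderHom.monotone (Fin.zero_le ((inv g).top.toOrderHom 0))
    rw [top_inv_top] at this
    exact Fin.le_zero_iff.1 this
  last := by
    have := g.top.toOrderHom.monotone (Fin.le_last ((inv g).top.toOrderHom (Fin.last _)))
    rw [top_inv_top] at this
    exact Fin.last_le_iff.1 this
  marked e he := by
    refine ⟨edgeMap (inv g) (inert_of_isIso _) e, ?_, ?_, ?_⟩
    · change X.η.toOrderHom _ = X.η.toOrderHom _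
      rw [castSucc_edgeMap, succ_edgeMap]
      exact η_eq_of_mem_markedEdges _ he
    · rw [castSucc_edgeMap, top_inv_top]
    · rw [succ_edgeMap, top_inv_top]

/-- There is a covering morphism out of `X` with any prescribed distances between the images of
consecutive vertices. -/
theorem exists_covering (X : FatDelta) (t : Fin (X.dom.len + 1) → ℕ) (ht : StrictMono t)
    (h0 : t 0 = 0) :
    ∃ (Z : FatDelta) (g : X ⟶ Z), Covering g ∧ ∀ i, (g.top.toOrderHom i).val = t i := by
  let n := t (Fin.last _)
  let t' : Fin (X.dom.len + 1) → Fin (n + 1) := fun i =>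
    ⟨t i, Nat.lt_succ_of_le (ht.monotone (Fin.le_last i))⟩
  have ht' : StrictMono t' := fun i j h => ht h
  -- The least marking that makes `t'` a morphism, and the only one that makes it covering.
  let s : Set (Fin n) :=
    {e | ∃ e' ∈ X.markedEdges, t' e'.castSucc ≤ e.castSucc ∧ e.succ ≤ t' e'.succ}
  obtain ⟨g, hg⟩ := exists_hom (X := X) (Y := ofMarks n s) t' ht' (by
    intro e he
    refine Fin.eq_of_adjacent (f := fun k => (ofMarks n s).η.toOrderHom k)
      (ht'.monotone (Fin.castSucc_lt_succ).le) fun k h₁ h₂ => ?_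
    have hk : k ∈ (ofMarks n s).markedEdges := by
      rw [markedEdges_ofMarks]
      exact ⟨e, he, h₁, h₂⟩
    exact hk)
  refine ⟨_, g, ⟨(hg 0).trans (Fin.ext h0), (hg _).trans (Fin.ext rfl), fun e he => ?_⟩,
    fun i => congrArg Fin.val (hg i)⟩
  rw [markedEdges_ofMarks] at he
  obtain ⟨e', he', h₁, h₂⟩ := he
  exact ⟨e', he', (hg _).trans_le h₁, h₂.trans (hg _).ge⟩

/-- The covering part is `g` shifted so as to start at `0`; the inert part is the translation by `g
0`. The translation respects marks because a marked edge of `Z` lies below a marked edge of `X`,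
whose image under `g` is collapsed. -/
theorem exists_covering_inert {X Y : FatDelta} (g : X ⟶ Y) :
    ∃ (Z : FatDelta) (l : X ⟶ Z) (r : Z ⟶ Y), Covering l ∧ inert r ∧ l ≫ r = g := by
  have hmono := g.top.toOrderHom.monotone
  have h0 : ∀ i, (g.top.toOrderHom 0).val ≤ (g.top.toOrderHom i).val := fun i => hmono (Fin.zero_le i)
  obtain ⟨Z, l, hl, hlt⟩ := exists_covering X
    (fun i => (g.top.toOrderHom i).val - (g.top.toOrderHom 0).val) (fun i j hij => by
      have h₁ := strictMono_top g hij
      have h₂ := h0 i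
      simp only [Fin.lt_def] at h₁ ⊢
      omega) (Nat.sub_self _)
  have hlast := hlt (Fin.last _)
  rw [hl.last, Fin.val_last] at hlast
  obtain ⟨r, hr⟩ := exists_hom (X := Z) (Y := Y)
    (fun i => ⟨(g.top.toOrderHom 0).val + i.val, by
      have h₁ := (g.top.toOrderHom (Fin.last _)).isLt
      have h₂ := i.isLt
      have h₃ := h0 (Fin.last _)
      omega⟩) (fun i j hij => by
      simp only [Fin.lt_def] at hij ⊢
      omega) (by
      intro e he
      obtain ⟨e', he', h₁, h₂⟩ := hl.marked e he
      have h₃ := hlt e'.castSucc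
      have h₄ := hlt e'.succ
      have h₅ := h0 e'.castSucc
      have h₆ := h0 e'.succ
      simp only [Fin.le_def, Fin.val_succ, Fin.val_castSucc] at h₁ h₂
      refine Y.η.toOrderHom.monotone.eq_of_between (a := g.top.toOrderHom e'.castSucc)
        (d := g.top.toOrderHom e'.succ) ?_ ?_ ?_ (η_eq_of_mem_markedEdges g he') <;>
      · simp only [Fin.le_def, Fin.val_succ, Fin.val_castSucc]
        omega)
  refine ⟨Z, l, r, hl, fun i => ?_, hom_ext fun i => Fin.ext ?_⟩
  · rw [hr, hr]
    simp only [Fin.val_succ, Fin.val_castSucc]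
    omega
  · change (r.top.toOrderHom (l.top.toOrderHom i)).val = _
    rw [hr]
    have := h0 i
    have := hlt i
    simp only
    omega

/-- A covering morphism is left orthogonal to inert morphisms. -/
theorem Covering.existsUnique_lift {A B X Y : FatDelta} {l : A ⟶ B} {r : X ⟶ Y} {s : A ⟶ X}
    {t : B ⟶ Y} (hl : Covering l) (hr : inert r) (h : s ≫ r = l ≫ t) :
    ∃! d : B ⟶ X, l ≫ d = s ∧ d ≫ r = t := by
  have hw : ∀ i, r.top.toOrderHom (s.top.toOrderHom i) = t.top.toOrderHom (l.top.toOrderHom i) :=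
    fun i => congrArg (fun f : A ⟶ Y => f.top.toOrderHom i) h
  have hrv := inert_add r hr
  have hwv : ∀ i, (r.top.toOrderHom 0).val + (s.top.toOrderHom i).val =
      (t.top.toOrderHom (l.top.toOrderHom i)).val := fun i => by rw [← hrv, hw]
  -- As `r` is a translation by `r 0`, the lift has to be `t - r 0`. It lands in `X` because `l`
  -- reaches both endpoints of `B`, where `t` is controlled by `s`.
  have hlow : ∀ i, (r.top.toOrderHom 0).val ≤ (t.top.toOrderHom i).val := fun i => by
    have h₁ := t.top.toOrderHom.monotone (Fin.zero_le i)
    have h₂ := hwv 0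
    rw [hl.zero] at h₂
    rw [Fin.le_def] at h₁
    omega
  have hup : ∀ i, (t.top.toOrderHom i).val < (r.top.toOrderHom 0).val + (X.dom.len + 1) := fun i => by
    have h₁ := t.top.toOrderHom.monotone (Fin.le_last i)
    have h₂ := hwv (Fin.last _)
    rw [hl.last] at h₂
    rw [Fin.le_def] at h₁
    have := (s.top.toOrderHom (Fin.last _)).isLt
    omega
  obtain ⟨d, hd⟩ := exists_hom (X := B) (Y := X)
    (fun i => ⟨(t.top.toOrderHom i).val - (r.top.toOrderHom 0).val, by
      have := hlow i
      have := hup i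
      omega⟩) (fun i j hij => by
      have h₁ := strictMono_top t hij
      have h₂ := hlow i
      simp only [Fin.lt_def] at h₁ ⊢
      omega) (by
      intro e he
      obtain ⟨e', he', h₁, h₂⟩ := hl.marked e he
      have h₃ := t.top.toOrderHom.monotone h₁
      have h₄ := t.top.toOrderHom.monotone h₂
      have h₅ := t.top.toOrderHom.monotone (Fin.castSucc_lt_succ (i := e)).le
      have h₆ := hwv e'.castSucc
      have h₇ := hwv e'.succ
      simp only [Fin.le_def] at h₃ h₄ h₅
      refine X.η.toOrderHom.monotone.eq_of_between (a := s.top.toOrderHom e'.castSucc)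
        (d := s.top.toOrderHom e'.succ) ?_ ?_ ?_ (η_eq_of_mem_markedEdges s he') <;>
      · simp only [Fin.le_def]
        omega)
  have hdr : d ≫ r = t := hom_ext fun i => Fin.ext (by
    change (r.top.toOrderHom (d.top.toOrderHom i)).val = _
    rw [hrv, hd]
    have := hlow i
    simp only
    omega)
  -- Morphisms of fat Delta are monic; this gives the other triangle as well as uniqueness.
  have hinj : ∀ {W : FatDelta} (a b : W ⟶ X), a ≫ r = b ≫ r → a = b := fun a b hab =>
    hom_ext fun i => (strictMono_top r).injective (congrArg (fun f => f.top.toOrderHom i) hab)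
  refine ⟨d, ⟨hinj _ _ ?_, hdr⟩, fun d' hd' => hinj _ _ ?_⟩
  · rw [Category.assoc, hdr, h]
  · rw [hd'.2, hdr]

/-- The translation `f` hits both endpoints, so it is the identity on vertices. Its inverse respects
marks: a marked edge of `b` lies below a marked edge of `X`, whose image in `a` is already
collapsed. -/
theorem isIso_of_covering_comp {X : FatDelta} {a b : Inert} (g : X ⟶ a.obj) (f : a ⟶ b)
    (h : Covering (g ≫ f.hom)) : IsIso f := by
  have hv := inert_add f.hom f.property
  have hz : (f.hom.top.toOrderHom 0).val = 0 := by
    have h₁ := f.hom.top.toOrderHom.monotone (Fin.zero_le (g.top.toOrderHom 0))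
    have h₂ : f.hom.top.toOrderHom (g.top.toOrderHom 0) = 0 := h.zero
    rw [h₂] at h₁
    exact congrArg Fin.val (Fin.le_zero_iff.1 h₁)
  have hl : b.obj.dom.len ≤ a.obj.dom.len := by
    have h₁ := hv (g.top.toOrderHom (Fin.last _))
    have h₂ : f.hom.top.toOrderHom (g.top.toOrderHom (Fin.last _)) = Fin.last _ := h.last
    have h₃ := (g.top.toOrderHom (Fin.last _)).isLt
    rw [h₂, Fin.val_last] at h₁
    omega
  obtain ⟨k, hk⟩ := exists_hom (X := b.obj) (Y := a.obj)
    (fun i => ⟨i.val, by omega⟩) (fun i j hij => hij) (by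
      intro e he
      obtain ⟨e', he', h₁, h₂⟩ := h.marked e he
      have h₃ := hv (g.top.toOrderHom e'.castSucc)
      have h₄ := hv (g.top.toOrderHom e'.succ)
      change f.hom.top.toOrderHom (g.top.toOrderHom e'.castSucc) ≤ _ at h₁
      change _ ≤ f.hom.top.toOrderHom (g.top.toOrderHom e'.succ) at h₂
      simp only [Fin.le_def, Fin.val_succ, Fin.val_castSucc] at h₁ h₂
      refine a.obj.η.toOrderHom.monotone.eq_of_between (a := g.top.toOrderHom e'.castSucc)
        (d := g.top.toOrderHom e'.succ) ?_ ?_ ?_ (η_eq_of_mem_markedEdges g he') <;>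
      · simp only [Fin.le_def, Fin.val_succ, Fin.val_castSucc]
        omega)
  have hki : inert k := fun i => by rw [hk, hk]; rfl
  refine ⟨⟨k, hki⟩, WideSubcategory.hom_ext _ (hom_ext fun i => Fin.ext ?_),
    WideSubcategory.hom_ext _ (hom_ext fun i => Fin.ext ?_)⟩
  · change (k.top.toOrderHom (f.hom.top.toOrderHom i)).val = i.val
    rw [hk]
    simp [hv i, hz]
  · change (f.hom.top.toOrderHom (k.top.toOrderHom i)).val = i.val
    rw [hv, hk]
    simp [hz]

/-! ### Generic and free morphisms of fat Delta. -/

theorem bijective_inertInclusion_obj : Function.Bijective inertInclusion.obj :=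
  ⟨fun ⟨_⟩ ⟨_⟩ h => congrArg _ h, fun X => ⟨⟨X⟩, rfl⟩⟩

/-- In the covering-inert factorisation of a generic morphism the inert factor is invertible, and
isomorphisms are covering. -/
theorem genericMorphisms_iff_covering {X Y : FatDelta} (g : X ⟶ Y) :
    genericMorphisms inertInclusion g ↔ Covering g := by
  refine (genericMorphisms_obj_iff bijective_inertInclusion_obj.1 (b := ⟨Y⟩) g).trans ?_
  constructor
  · intro h
    obtain ⟨Z, l, r, hl, hr, rfl⟩ := exists_covering_inert g
    have := h ⟨Z⟩ ⟨r, hr⟩ l rfl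
    have : IsIso r := inferInstanceAs (IsIso (inertInclusion.map (⟨r, hr⟩ : (⟨Z⟩ : Inert) ⟶ ⟨Y⟩)))
    exact hl.comp (covering_of_isIso r)
  · rintro h a f g' rfl
    exact isIso_of_covering_comp g' f h

theorem freeMorphisms_iff {X Y : FatDelta} (g : X ⟶ Y) :
    freeMorphisms inertInclusion g ↔ inert g := by
  constructor
  · rintro ⟨_⟩
    rename_i f _
    exact f.property
  · intro h
    exact MorphismProperty.map_mem_strictMap _ inertInclusion (⟨g, h⟩ : (⟨X⟩ : Inert) ⟶ ⟨Y⟩) trivial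

/-- The generic and the free morphisms form an orthogonal factorisation system on fat Delta. -/
theorem isOrthogonalFactorizationSystem :
    IsOrthogonalFactorizationSystem (genericMorphisms inertInclusion)
      (freeMorphisms inertInclusion) where
  isos_le_left X Y g hg := by
    have : IsIso g := hg
    exact (genericMorphisms_iff_covering g).2 (covering_of_isIso g)
  isos_le_right X Y g hg := by
    have : IsIso g := hg
    exact (freeMorphisms_iff g).2 (inert_of_isIso g)
  comp_left := ⟨fun f g hf hg => by
    rw [genericMorphisms_iff_covering] at *
    exact hf.comp hg⟩
  comp_right := ⟨fun f g hf hg => by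
    rw [freeMorphisms_iff] at *
    exact inert.comp_mem _ _ hf hg⟩
  factorization g := by
    obtain ⟨Z, l, r, hl, hr, h⟩ := exists_covering_inert g
    exact ⟨Z, l, r, (genericMorphisms_iff_covering l).2 hl, (freeMorphisms_iff r).2 hr, h⟩
  orthogonal l r s t hl hr h :=
    ((genericMorphisms_iff_covering l).1 hl).existsUnique_lift ((freeMorphisms_iff r).1 hr) h

end FatDelta

/-! ### Paths in linear graphs and the Kleisli category of the free relative semicategory monad -/

namespace RelGraph

namespace Path

variable {G H : RelGraph.{u}}

theorem ext_edges {p q : Path G} (h : p.edges = q.edges) : p = q :=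
  Path.ext (List.cons.inj h).1 (List.cons.inj h).2

theorem length_edges_pos (p : Path G) : 0 < p.edges.length := Nat.succ_pos _

theorem src_getElem_zero (p : Path G) : G.src (p.edges[0]'p.length_edges_pos) = p.src := rfl

theorem tgt_eq_getElem (p : Path G) {i : ℕ} (hi : i + 1 = p.edges.length) :
    p.tgt = G.tgt (p.edges[i]'(by omega)) := by
  unfold tgt
  congr 1
  rw [List.getLast_eq_getElem]
  congr 1
  omega

theorem tgt_getElem (p : Path G) (i : ℕ) (hi : i + 1 < p.edges.length) :
    G.tgt (p.edges[i]'(by omega)) = G.src (p.edges[i + 1]'hi) :=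
  List.isChain_iff_getElem.1 p.chain i hi

section Linear

variable {n : ℕ} {s : Set (Fin n)}

/-- Composability forces the edges to be consecutive, so a path in a linear graph is an interval.
This is why such paths are determined by their endpoints. -/
theorem getElem_linear (p : Path (linear.{u} n s)) (i : ℕ) (hi : i < p.edges.length) :
    (p.edges[i]'hi).down.val = p.src.down.val + i := by
  induction i with
  | zero => exact congrArg (fun v : (linear.{u} n s).V => v.down.val) p.src_getElem_zero
  | succ i ih =>
    have h := congrArg (fun v : (linear.{u} n s).V => v.down.val) (p.tgt_getElem i hi)
    have h' := ih (by omega)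
    change (p.edges[i]'(by omega)).down.val + 1 = (p.edges[i + 1]'hi).down.val at h
    omega

theorem tgt_linear (p : Path (linear.{u} n s)) :
    p.tgt.down.val = p.src.down.val + p.edges.length := by
  have h := p.length_edges_pos
  rw [p.tgt_eq_getElem (i := p.edges.length - 1) (by omega)]
  change (p.edges[p.edges.length - 1]'(by omega)).down.val + 1 = _
  rw [getElem_linear]
  omega

theorem ext_linear {p q : Path (linear.{u} n s)} (hs : p.src = q.src) (ht : p.tgt = q.tgt) :
    p = q := by
  have h₁ := p.tgt_linear
  have h₂ := q.tgt_linear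
  rw [hs, ht] at h₁
  refine ext_edges (List.ext_getElem (by omega) fun i hi hi' => ?_)
  refine ULift.ext _ _ (Fin.ext ?_)
  rw [getElem_linear, getElem_linear, hs]

theorem mem_edges_linear (p : Path (linear.{u} n s)) (e : (linear.{u} n s).E) :
    e ∈ p.edges ↔ p.src.down ≤ e.down.castSucc ∧ e.down.succ ≤ p.tgt.down := by
  simp only [Fin.le_def, Fin.val_succ, Fin.val_castSucc, tgt_linear]
  constructor
  · intro h
    obtain ⟨i, hi, rfl⟩ := List.getElem_of_mem h
    rw [getElem_linear]
    omega
  · rintro ⟨h₁, h₂⟩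
    have : e = p.edges[e.down.val - p.src.down.val]'(by omega) := by
      refine ULift.ext _ _ (Fin.ext ?_)
      rw [getElem_linear]
      omega
    rw [this]
    exact List.getElem_mem _

theorem exists_linear (a b : Fin (n + 1)) (hab : a < b) :
    ∃ p : Path (linear.{u} n s), p.src = ⟨a⟩ ∧ p.tgt = ⟨b⟩ := by
  induction b using Fin.induction with
  | zero => exact absurd hab (Fin.not_lt_zero _)
  | succ b ih =>
    by_cases h : a < b.castSucc
    · obtain ⟨p, hs, ht⟩ := ih h
      refine ⟨p.append (single ⟨b⟩) ht, hs, ?_⟩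
      exact (RelSemiCat.pathSemiCat (linear.{u} n s)).tgt_comp p (single ⟨b⟩) ht
    · refine ⟨single ⟨b⟩, ?_, rfl⟩
      refine ULift.ext _ _ (Fin.ext ?_)
      change b.val = a.val
      simp only [Fin.lt_def, Fin.val_succ, Fin.val_castSucc] at h hab
      omega

end Linear

end Path

/-- A morphism from a linear graph to the paths of a linear graph is determined by its action on
vertices. -/
theorem linear_hom_path_ext {m n : ℕ} {r : Set (Fin m)} {s : Set (Fin n)}
    {f g : linear.{u} m r ⟶ (RelSemiCat.pathSemiCat (linear.{u} n s)).toRelGraph}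
    (h : ∀ v, f.onV v = g.onV v) : f = g := by
  refine hom_ext h fun e => Path.ext_linear ?_ ?_
  · exact (f.src_onE e).trans ((h _).trans (g.src_onE e).symm)
  · exact (f.tgt_onE e).trans ((h _).trans (g.tgt_onE e).symm)

end RelGraph

namespace FatDelta

open RelGraph RelSemiCat

/-- The linear relative graph of an object of fat Delta. -/
abbrev graph (X : FatDelta) : RelGraph.{u} := linear X.dom.len X.markedEdges

/-- Paths are nonempty, so vertices move strictly upwards along each edge; a marked edge goes to a
path of marked edges, that is, to a collapsed interval. -/
theorem exists_top {X Y : FatDelta}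
    (f : X.graph ⟶ (pathSemiCat.{u} Y.graph).toRelGraph) :
    ∃ g : X ⟶ Y, ∀ i, g.top.toOrderHom i = (f.onV ⟨i⟩ : Y.graph.V).down := by
  refine exists_hom _ (Fin.strictMono_iff_lt_succ.2 fun e => ?_) fun e he => ?_
  · have h := Path.tgt_linear (f.onE ⟨e⟩ : Y.graph.Path)
    have h' := Path.length_edges_pos (f.onE ⟨e⟩ : Y.graph.Path)
    have hs : (f.onE ⟨e⟩ : Y.graph.Path).src = f.onV ⟨e.castSucc⟩ := f.src_onE ⟨e⟩
    have ht : (f.onE ⟨e⟩ : Y.graph.Path).tgt = f.onV ⟨e.succ⟩ := f.tgt_onE ⟨e⟩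
    rw [hs, ht] at h
    rw [Fin.lt_def]
    omega
  · have hm : ∀ k ∈ (f.onE ⟨e⟩ : Y.graph.Path).edges, k ∈ Y.graph.marked := f.marked_onE ⟨e⟩ he
    have h := Path.tgt_linear (f.onE ⟨e⟩ : Y.graph.Path)
    have hs : (f.onE ⟨e⟩ : Y.graph.Path).src = f.onV ⟨e.castSucc⟩ := f.src_onE ⟨e⟩
    have ht : (f.onE ⟨e⟩ : Y.graph.Path).tgt = f.onV ⟨e.succ⟩ := f.tgt_onE ⟨e⟩
    refine Fin.eq_of_adjacent (f := fun k => Y.η.toOrderHom k) ?_ fun k h₁ h₂ => ?_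
    · rw [hs, ht] at h
      rw [Fin.le_def]
      omega
    · refine hm ⟨k⟩ ((Path.mem_edges_linear _ _).2 ?_)
      rw [hs, ht]
      exact ⟨h₁, h₂⟩

theorem exists_hom_path {X Y : FatDelta} (g : X ⟶ Y) :
    ∃ f : X.graph ⟶ (pathSemiCat.{u} Y.graph).toRelGraph,
      ∀ v, f.onV v = ⟨g.top.toOrderHom v.down⟩ := by
  choose p hs ht using fun e : Fin X.dom.len =>
    Path.exists_linear.{u} (s := Y.markedEdges) _ _ (strictMono_top g (Fin.castSucc_lt_succ (i := e)))
  refine ⟨{ onV := fun v => ⟨g.top.toOrderHom v.down⟩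
            onE := fun e => p e.down
            src_onE := fun e => hs e.down
            tgt_onE := fun e => ht e.down
            marked_onE := fun e he k hk => ?_ }, fun v => rfl⟩
  have hk' := (Path.mem_edges_linear _ _).1 hk
  rw [hs, ht] at hk'
  exact Y.η.toOrderHom.monotone.eq_of_between hk'.1 (Fin.castSucc_lt_succ).le hk'.2
    (η_eq_of_mem_markedEdges g he)

/-- The theory associated with the free relative semicategory monad. -/
abbrev Theory : Type := MonadTheory relSemiCatMonad.{u} toRelGraph.{u}

/-- The Kleisli morphism corresponding to a morphism of free algebras. -/
def kleisli {A B : RelGraph.{u}} (h : relSemiCatMonad.free.obj A ⟶ relSemiCatMonad.free.obj B) :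
    A ⟶ (pathSemiCat B).toRelGraph :=
  relSemiCatMonad.adj.homEquiv A (relSemiCatMonad.free.obj B) h

theorem kleisli_bijective (A B : RelGraph.{u}) : Function.Bijective (kleisli (A := A) (B := B)) :=
  (relSemiCatMonad.adj.homEquiv A (relSemiCatMonad.free.obj B)).bijective

theorem exists_toFatDelta {X Y : Theory.{u}} (h : X ⟶ Y) :
    ∃ g : X.obj ⟶ Y.obj, ∀ i, g.top.toOrderHom i = (h.hom.f.onV ⟨i⟩ : Y.obj.graph.V).down :=
  -- The unit is the identity on vertices, so `h` and its Kleisli form agree there.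
  exists_top (kleisli h.hom)

/-- The comparison functor from the theory of the monad to fat Delta. -/
noncomputable def toFatDelta : Theory.{u} ⥤ FatDelta where
  obj X := X.obj
  map h := (exists_toFatDelta h).choose
  map_id X := hom_ext fun i => (exists_toFatDelta (𝟙 X)).choose_spec i
  map_comp {X Y Z} f g := hom_ext fun i => by
    rw [(exists_toFatDelta (f ≫ g)).choose_spec i]
    change _ = (exists_toFatDelta g).choose.top.toOrderHom
      ((exists_toFatDelta f).choose.top.toOrderHom i)
    rw [(exists_toFatDelta g).choose_spec, (exists_toFatDelta f).choose_spec]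
    rfl

theorem toFatDelta_map_top {X Y : Theory.{u}} (h : X ⟶ Y) (i) :
    (toFatDelta.map h).top.toOrderHom i = (h.hom.f.onV ⟨i⟩ : Y.obj.graph.V).down :=
  (exists_toFatDelta h).choose_spec i

/-- Morphisms on either side are determined by their action on vertices, and `exists_top` and
`exists_hom_path` realise the same vertex maps. -/
theorem toFatDelta_map_bijective (X Y : Theory.{u}) :
    Function.Bijective (toFatDelta.map : (X ⟶ Y) → _) := by
  constructor
  · intro h k hk
    refine InducedCategory.hom_ext ((kleisli_bijective _ _).1 (linear_hom_path_ext fun v => ?_))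
    have := congrArg (fun f : X.obj ⟶ Y.obj => f.top.toOrderHom v.down) hk
    exact ULift.ext _ _ ((toFatDelta_map_top h _).symm.trans (this.trans (toFatDelta_map_top k _)))
  · intro g
    obtain ⟨f, hf⟩ := exists_hom_path.{u} g
    obtain ⟨h, rfl⟩ := (kleisli_bijective _ _).2 f
    refine ⟨InducedCategory.homMk h, hom_ext fun i => ?_⟩
    rw [toFatDelta_map_top]
    exact congrArg ULift.down (hf ⟨i⟩)

instance : toFatDelta.{u}.Full := ⟨fun {_ _} => (toFatDelta_map_bijective _ _).2⟩

instance : toFatDelta.{u}.Faithful := ⟨fun {_ _} => (toFatDelta_map_bijective _ _).1⟩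

/-- An object of fat Delta as an object of the theory of the monad. -/
abbrev theoryObj (X : FatDelta) : Theory.{u} := (⟨X⟩ : Inert)

theorem toFatDelta_map_j {X Y : Inert} (f : X ⟶ Y) :
    toFatDelta.map ((MonadTheory.j relSemiCatMonad.{u} toRelGraph.{u}).map f) = f.hom :=
  hom_ext fun i => toFatDelta_map_top _ i

/-- The morphism of free algebras corresponding to a morphism of fat Delta. -/
noncomputable def lift {X Y : FatDelta} (g : X ⟶ Y) : theoryObj.{u} X ⟶ theoryObj Y :=
  ((toFatDelta_map_bijective (theoryObj X) (theoryObj Y)).2 g).choose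

theorem toFatDelta_map_lift {X Y : FatDelta} (g : X ⟶ Y) : toFatDelta.{u}.map (lift g) = g :=
  ((toFatDelta_map_bijective (theoryObj X) (theoryObj Y)).2 g).choose_spec

theorem lift_toFatDelta_map {X Y : Theory.{u}} (h : X ⟶ Y) : lift (toFatDelta.map h) = h :=
  (toFatDelta_map_bijective X Y).1 (toFatDelta_map_lift _)

theorem lift_comp {X Y Z : FatDelta} (f : X ⟶ Y) (g : Y ⟶ Z) :
    lift.{u} (f ≫ g) = lift f ≫ lift g :=
  toFatDelta.map_injective ((toFatDelta_map_lift _).trans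
    ((congrArg₂ (· ≫ ·) (toFatDelta_map_lift f).symm (toFatDelta_map_lift g).symm).trans
      (toFatDelta.map_comp _ _).symm))

theorem lift_inert {X Y : Inert} (f : X ⟶ Y) :
    lift.{u} f.hom = (MonadTheory.j relSemiCatMonad.{u} toRelGraph.{u}).map f :=
  (toFatDelta_map_bijective X Y).1 ((toFatDelta_map_lift _).trans (toFatDelta_map_j.{u} f).symm)

/-- The inverse of the comparison functor. -/
noncomputable def ofFatDelta : FatDelta ⥤ Theory.{u} where
  obj := theoryObj
  map := lift
  map_id X := toFatDelta.{u}.map_injective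
    ((toFatDelta_map_lift _).trans (toFatDelta.{u}.map_id (theoryObj X)).symm)
  map_comp := lift_comp

theorem toFatDelta_comp_ofFatDelta : toFatDelta.{u} ⋙ ofFatDelta.{u} = 𝟭 _ :=
  CategoryTheory.Functor.hext (fun _ => rfl) fun _ _ f => heq_of_eq (lift_toFatDelta_map f)

theorem ofFatDelta_comp_toFatDelta : ofFatDelta.{u} ⋙ toFatDelta.{u} = 𝟭 _ :=
  CategoryTheory.Functor.hext (fun _ => rfl) fun _ _ f => heq_of_eq (toFatDelta_map_lift f)

theorem j_comp_toFatDelta :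
    MonadTheory.j relSemiCatMonad.{u} toRelGraph.{u} ⋙ toFatDelta = inertInclusion :=
  CategoryTheory.Functor.hext (fun _ => rfl) fun _ _ f => heq_of_eq (toFatDelta_map_j.{u} f)

end FatDelta

/-! ### The universal property of covering morphisms -/

namespace FatDelta

open RelGraph RelSemiCat

/-- The vertices of the linear graph of an object of fat Delta. -/
def vertex (X : FatDelta) (i : Fin (X.dom.len + 1)) : X.graph.{u}.V := ⟨i⟩

/-- The edges of the linear graph of an object of fat Delta. -/
def edge (X : FatDelta) (e : Fin X.dom.len) : X.graph.{u}.E := ⟨e⟩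

theorem edge_mem_marked {X : FatDelta} {e : Fin X.dom.len} :
    X.edge e ∈ X.graph.{u}.marked ↔ e ∈ X.markedEdges := Iff.rfl

theorem graph_hom_ext {X : FatDelta} {Z : RelGraph.{u}} {f g : X.graph ⟶ Z}
    (hV : ∀ i, f.onV (X.vertex i) = g.onV (X.vertex i))
    (hE : ∀ e, f.onE (X.edge e) = g.onE (X.edge e)) : f = g :=
  RelGraph.hom_ext (fun v => hV v.down) fun e => hE e.down

/-- Morphisms out of the linear graph of an object of fat Delta. -/
theorem exists_graph_hom {X : FatDelta} {Z : RelGraph.{u}} (V : Fin (X.dom.len + 1) → Z.V)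
    (E : Fin X.dom.len → Z.E) (hs : ∀ e, Z.src (E e) = V e.castSucc)
    (ht : ∀ e, Z.tgt (E e) = V e.succ) (hm : ∀ e ∈ X.markedEdges, E e ∈ Z.marked) :
    ∃ x : X.graph ⟶ Z, (∀ i, x.onV (X.vertex i) = V i) ∧ ∀ e, x.onE (X.edge e) = E e :=
  ⟨{ onV := fun v => V v.down
     onE := fun e => E e.down
     src_onE := fun e => hs e.down
     tgt_onE := fun e => ht e.down
     marked_onE := fun e he => hm e.down he }, fun _ => rfl, fun _ => rfl⟩

/-- Composition of a morphism into a graph of paths with the image of a morphism of graphs. -/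
def mapPath {A Z W : RelGraph.{u}} (φ : A ⟶ (pathSemiCat Z).toRelGraph) (x : Z ⟶ W) :
    A ⟶ (pathSemiCat W).toRelGraph :=
  φ ≫ relSemiCatMonad.map x

theorem mapPath_comp {A Z W U : RelGraph.{u}} (φ : A ⟶ (pathSemiCat Z).toRelGraph) (x : Z ⟶ W)
    (y : W ⟶ U) : mapPath φ (x ≫ y) = mapPath (mapPath φ x) y := by
  unfold mapPath
  rw [relSemiCatMonad.map_comp]
  rfl

section PathAt

variable {X : FatDelta} {Z : RelGraph.{u}} (φ : X.graph ⟶ (pathSemiCat Z).toRelGraph)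

/-- The path assigned to an edge by a morphism into a graph of paths. -/
def pathAt (e : Fin X.dom.len) : Z.Path := φ.onE (X.edge e)

/-- The vertex assigned to a vertex by a morphism into a graph of paths. -/
def vertexAt (i : Fin (X.dom.len + 1)) : Z.V := φ.onV (X.vertex i)

theorem src_pathAt (e : Fin X.dom.len) : (pathAt φ e).src = vertexAt φ e.castSucc :=
  φ.src_onE (X.edge e)

theorem tgt_pathAt (e : Fin X.dom.len) : (pathAt φ e).tgt = vertexAt φ e.succ :=
  φ.tgt_onE (X.edge e)

theorem marked_pathAt {e : Fin X.dom.len} (he : e ∈ X.markedEdges) :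
    ∀ k ∈ (pathAt φ e).edges, k ∈ Z.marked := φ.marked_onE (X.edge e) he

theorem pathAt_ext {φ ψ : X.graph ⟶ (pathSemiCat Z).toRelGraph}
    (hV : ∀ i, vertexAt φ i = vertexAt ψ i) (hE : ∀ e, (pathAt φ e).edges = (pathAt ψ e).edges) :
    φ = ψ :=
  graph_hom_ext hV fun e => Path.ext_edges (hE e)

theorem edges_pathAt_mapPath {W : RelGraph.{u}} (x : Z ⟶ W) (e : Fin X.dom.len) :
    (pathAt (mapPath φ x) e).edges = (pathAt φ e).edges.map x.onE := rfl

theorem vertexAt_mapPath {W : RelGraph.{u}} (x : Z ⟶ W) (i : Fin (X.dom.len + 1)) :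
    vertexAt (mapPath φ x) i = x.onV (vertexAt φ i) := rfl

end PathAt

/-- The paths in `Y` corresponding to the edges of `X` under a morphism of fat Delta. -/
noncomputable def pathHom {X Y : FatDelta} (g : X ⟶ Y) :
    X.graph ⟶ (pathSemiCat.{u} Y.graph).toRelGraph :=
  kleisli (lift g).hom

section PathHom

variable {X Y : FatDelta} (g : X ⟶ Y)

theorem vertexAt_pathHom (i : Fin (X.dom.len + 1)) :
    vertexAt (pathHom.{u} g) i = Y.vertex (g.top.toOrderHom i) :=
  ULift.ext _ _ ((toFatDelta_map_top (lift.{u} g) i).symm.trans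
    (congrArg (fun f : X ⟶ Y => f.top.toOrderHom i) (toFatDelta_map_lift g)))

theorem src_pathAt_pathHom (e : Fin X.dom.len) :
    (pathAt (pathHom.{u} g) e).src = Y.vertex (g.top.toOrderHom e.castSucc) :=
  (src_pathAt _ e).trans (vertexAt_pathHom g _)

theorem tgt_pathAt_pathHom (e : Fin X.dom.len) :
    (pathAt (pathHom.{u} g) e).tgt = Y.vertex (g.top.toOrderHom e.succ) :=
  (tgt_pathAt _ e).trans (vertexAt_pathHom g _)

theorem add_length_pathAt_pathHom (e : Fin X.dom.len) :
    (g.top.toOrderHom e.castSucc).val + (pathAt (pathHom.{u} g) e).edges.length =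
      (g.top.toOrderHom e.succ).val := by
  have h := Path.tgt_linear (pathAt (pathHom.{u} g) e)
  rw [src_pathAt_pathHom, tgt_pathAt_pathHom] at h
  exact h.symm

theorem exists_getElem_pathAt_pathHom (e : Fin X.dom.len) (i : ℕ)
    (hi : i < (pathAt (pathHom.{u} g) e).edges.length) :
    ∃ k : Fin Y.dom.len, (pathAt (pathHom.{u} g) e).edges[i]'hi = Y.edge k ∧
      k.val = (g.top.toOrderHom e.castSucc).val + i := by
  refine ⟨((pathAt (pathHom.{u} g) e).edges[i]'hi).down, rfl, ?_⟩
  rw [Path.getElem_linear, src_pathAt_pathHom]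
  rfl

theorem getElem_pathAt_pathHom (e : Fin X.dom.len) (k : Fin Y.dom.len)
    (hk : (g.top.toOrderHom e.castSucc).val ≤ k.val)
    (hi : k.val - (g.top.toOrderHom e.castSucc).val < (pathAt (pathHom.{u} g) e).edges.length) :
    (pathAt (pathHom.{u} g) e).edges[k.val - (g.top.toOrderHom e.castSucc).val]'hi = Y.edge k := by
  obtain ⟨k', h, h'⟩ := exists_getElem_pathAt_pathHom g e _ hi
  rw [h]
  exact congrArg Y.edge (Fin.ext (by omega))

variable {g}

theorem block_unique {e e' : Fin X.dom.len} {k : ℕ}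
    (h₁ : (g.top.toOrderHom e.castSucc).val ≤ k) (h₂ : k < (g.top.toOrderHom e.succ).val)
    (h₁' : (g.top.toOrderHom e'.castSucc).val ≤ k) (h₂' : k < (g.top.toOrderHom e'.succ).val) :
    e = e' := by
  by_contra hne
  rcases lt_or_gt_of_ne hne with h | h
  · have := g.top.toOrderHom.monotone (Fin.le_def.2 (show e.succ.val ≤ e'.castSucc.val from h))
    rw [Fin.le_def] at this
    omega
  · have := g.top.toOrderHom.monotone (Fin.le_def.2 (show e'.succ.val ≤ e.castSucc.val from h))
    rw [Fin.le_def] at this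
    omega

/-- Together with `block_unique`: the paths that a covering morphism assigns to the edges of `X`
partition the edges of `Y`. -/
theorem Covering.exists_block (hg : Covering g) (k : Fin Y.dom.len) :
    ∃ e : Fin X.dom.len, (g.top.toOrderHom e.castSucc).val ≤ k.val ∧
      k.val < (g.top.toOrderHom e.succ).val :=
  Fin.exists_block _ hg.zero hg.last k

end PathHom

/-- A morphism of linear graphs comes from an inert morphism of fat Delta. -/
theorem exists_inert {X Y : Inert} (f : X.obj.graph ⟶ Y.obj.graph) :
    ∃ g : X ⟶ Y, toRelGraph.{u}.map g = f := by
  have hs : ∀ e, (f.onE (X.obj.edge e)).down.val = (f.onV (X.obj.vertex e.castSucc)).down.val :=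
    fun e => congrArg (fun v : Y.obj.graph.V => v.down.val) (f.src_onE (X.obj.edge e))
  have ht : ∀ e, (f.onE (X.obj.edge e)).down.val + 1 = (f.onV (X.obj.vertex e.succ)).down.val :=
    fun e => congrArg (fun v : Y.obj.graph.V => v.down.val) (f.tgt_onE (X.obj.edge e))
  obtain ⟨g, hg⟩ := exists_hom (X := X.obj) (Y := Y.obj) (fun i => (f.onV (X.obj.vertex i)).down)
    (Fin.strictMono_iff_lt_succ.2 fun e => by
      rw [Fin.lt_def, ← hs, ← ht]
      exact Nat.lt_succ_self _) (fun e he => by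
      have h : (f.onE (X.obj.edge e)).down ∈ Y.obj.markedEdges := f.marked_onE (X.obj.edge e) he
      have h₁ : (f.onE (X.obj.edge e)).down.castSucc = (f.onV (X.obj.vertex e.castSucc)).down :=
        Fin.ext (hs e)
      have h₂ : (f.onE (X.obj.edge e)).down.succ = (f.onV (X.obj.vertex e.succ)).down :=
        Fin.ext (ht e)
      rw [← h₁, ← h₂]
      exact h)
  have hi : inert g := fun e => by rw [hg, hg, ← hs, ← ht]
  refine ⟨⟨g, hi⟩, graph_hom_ext (fun i => ULift.ext _ _ (hg i)) fun e => ?_⟩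
  refine ULift.ext _ _ (Fin.ext ?_)
  rw [hs, ← hg]
  rfl

theorem inert_hom_ext {X Y : Inert} {f g : X ⟶ Y}
    (h : toRelGraph.{u}.map f = toRelGraph.{u}.map g) : f = g :=
  WideSubcategory.hom_ext _ (hom_ext fun i =>
    congrArg (fun k : X.obj.graph ⟶ Y.obj.graph => (k.onV (X.obj.vertex i)).down) h)

instance : toRelGraph.{u}.Full := ⟨exists_inert⟩

instance : toRelGraph.{u}.Faithful := ⟨inert_hom_ext⟩

section Universal

variable {X Y : FatDelta} {g : X ⟶ Y} {Z : RelGraph.{u}}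
  {φ : X.graph ⟶ (pathSemiCat Z).toRelGraph}

/-- Recovers `x` from its composite with `pathHom g`. The form `[_]?` lets equal composites be
rewritten without carrying bounds along. -/
theorem getElem_mapPath (x : Y.graph ⟶ Z) (e : Fin X.dom.len) (k : Fin Y.dom.len)
    (hk : (g.top.toOrderHom e.castSucc).val ≤ k.val)
    (hk' : k.val < (g.top.toOrderHom e.succ).val) :
    (pathAt (mapPath (pathHom g) x) e).edges[k.val -
      (g.top.toOrderHom e.castSucc).val]? = some (x.onE (Y.edge k)) := by
  have h := add_length_pathAt_pathHom.{u} g e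
  rw [edges_pathAt_mapPath, List.getElem?_map, List.getElem?_eq_getElem (by omega),
    getElem_pathAt_pathHom g e k hk]
  rfl

/-- Every edge of `Y` occurs in the path over some edge of `X`. Every vertex is the source of an
edge except the last one, which is the image of the last vertex of `X`. -/
theorem Covering.map_unique (hg : Covering g) {x x' : Y.graph ⟶ Z}
    (h : mapPath (pathHom g) x = mapPath (pathHom g) x') : x = x' := by
  have hE : ∀ k, x.onE (Y.edge k) = x'.onE (Y.edge k) := fun k => by
    obtain ⟨e, h₁, h₂⟩ := hg.exists_block k
    have h' := getElem_mapPath x e k h₁ h₂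
    rw [h, getElem_mapPath x' e k h₁ h₂] at h'
    exact (Option.some.inj h').symm
  refine graph_hom_ext (fun v => ?_) hE
  by_cases hv : v.val < Y.dom.len
  · have h₁ := x.src_onE (Y.edge ⟨v.val, hv⟩)
    have h₂ := x'.src_onE (Y.edge ⟨v.val, hv⟩)
    rw [hE] at h₁
    exact h₁.symm.trans h₂
  · have hvl : Y.vertex v = vertexAt (pathHom.{u} g) (Fin.last _) := by
      rw [vertexAt_pathHom, hg.last]
      exact congrArg Y.vertex (Fin.ext (by rw [Fin.val_last]; omega))
    have h₁ := congrArg (fun f => vertexAt f (Fin.last _)) h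
    simp only [vertexAt_mapPath] at h₁
    rw [hvl]
    exact h₁

/-- The paths of `φ` over successive edges of `X` can be concatenated. With the lengths prescribed
by `g`, edge `k` of `Y` goes to the edge at position `k` of the concatenation. -/
theorem Covering.exists_map (hg : Covering g)
    (hφ : ∀ e, (pathAt φ e).edges.length = (pathAt (pathHom.{u} g) e).edges.length) :
    ∃ x : Y.graph ⟶ Z, mapPath (pathHom g) x = φ := by
  have hlen : ∀ e : Fin X.dom.len, (g.top.toOrderHom e.castSucc).val +
      (pathAt φ e).edges.length = (g.top.toOrderHom e.succ).val := fun e => by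
    rw [hφ]
    exact add_length_pathAt_pathHom g e
  choose b hb₁ hb₂ using hg.exists_block
  let E : Fin Y.dom.len → Z.E := fun k =>
    (pathAt φ (b k)).edges[k.val - (g.top.toOrderHom (b k).castSucc).val]'(by
      have := hlen (b k)
      have := hb₁ k
      have := hb₂ k
      omega)
  have hE : ∀ (k : Fin Y.dom.len) (e : Fin X.dom.len) (i : ℕ)
      (hi : i < (pathAt φ e).edges.length),
      k.val = (g.top.toOrderHom e.castSucc).val + i → E k = (pathAt φ e).edges[i]'hi := by
    intro k e i hi hk
    have hbe : b k = e := by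
      have := hlen e
      exact block_unique (hb₁ k) (hb₂ k) (by omega) (by omega)
    subst hbe
    simp only [E]
    congr 1
    omega
  -- The last vertex is the source of no edge, so its value is taken from `φ`; this also covers the
  -- case without edges.
  let V : Fin (Y.dom.len + 1) → Z.V := fun v =>
    if h : v.val < Y.dom.len then Z.src (E ⟨v.val, h⟩) else vertexAt φ (Fin.last _)
  have hV : ∀ j : Fin (X.dom.len + 1), V (g.top.toOrderHom j) = vertexAt φ j := by
    intro j
    by_cases hj : j = Fin.last _
    · subst hj
      rw [hg.last]
      exact dif_neg (by simp)
    · obtain ⟨e, rfl⟩ := Fin.exists_castSucc_eq.2 hj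
      have hpos := (pathAt φ e).length_edges_pos
      have hlt : (g.top.toOrderHom e.castSucc).val < Y.dom.len := by
        have := hlen e
        have := (g.top.toOrderHom e.succ).isLt
        omega
      refine (dif_pos hlt).trans ?_
      rw [hE ⟨_, hlt⟩ e 0 hpos rfl, Path.src_getElem_zero, src_pathAt]
  obtain ⟨x, hxV, hxE⟩ := exists_graph_hom V E (fun k => (show V k.castSucc = _ from dif_pos k.isLt).symm) (fun k => by
    have h₁ := hb₁ k
    have h₂ := hb₂ k
    have h₃ := hlen (b k)
    -- Inside a block the targets match because the path is composable; at the end of a block,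
    -- because `φ` sends the next vertex of `X` to the target of the path.
    by_cases hc : k.val + 1 < (g.top.toOrderHom (b k).succ).val
    · have hlt : k.val + 1 < Y.dom.len := by
        have := (g.top.toOrderHom (b k).succ).isLt
        omega
      have hi : k.val - (g.top.toOrderHom (b k).castSucc).val + 1 <
        (pathAt φ (b k)).edges.length := by omega
      refine ((pathAt φ (b k)).tgt_getElem _ hi).trans ?_
      rw [← hE ⟨k.val + 1, hlt⟩ _ _ hi (by simp only; omega)]
      exact (show V k.succ = _ from dif_pos hlt).symm
    · have hk : k.succ = g.top.toOrderHom (b k).succ := Fin.ext (by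
        rw [Fin.val_succ]
        omega)
      rw [hk, hV]
      refine ((pathAt φ (b k)).tgt_eq_getElem ?_).symm.trans (tgt_pathAt φ _)
      omega) (fun k hk => by
    obtain ⟨e, he, h₁, h₂⟩ := hg.marked k hk
    rw [Fin.le_def] at h₁ h₂
    rw [Fin.val_castSucc] at h₁
    rw [Fin.val_succ] at h₂
    have h₃ := hlen e
    rw [hE k e (k.val - (g.top.toOrderHom e.castSucc).val) (by omega) (by omega)]
    exact marked_pathAt φ he _ (List.getElem_mem _))
  refine ⟨x, pathAt_ext (fun i => ?_) fun e => ?_⟩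
  · rw [vertexAt_mapPath, vertexAt_pathHom, hxV, hV]
  · rw [edges_pathAt_mapPath]
    refine List.ext_getElem (by rw [List.length_map, hφ]) fun i hi hi' => ?_
    rw [List.length_map] at hi
    obtain ⟨k, hk, hk'⟩ := exists_getElem_pathAt_pathHom g e i hi
    rw [List.getElem_map, hk, hxE]
    exact hE k e i hi' hk'

theorem length_pathAt_mapPath (φ : X.graph ⟶ (pathSemiCat Z).toRelGraph) {W : RelGraph.{u}}
    (x : Z ⟶ W) (e : Fin X.dom.len) :
    (pathAt (mapPath φ x) e).edges.length = (pathAt φ e).edges.length := by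
  rw [edges_pathAt_mapPath, List.length_map]

end Universal

theorem exists_covering_length {X : FatDelta} {Z : RelGraph.{u}}
    (φ : X.graph ⟶ (pathSemiCat Z).toRelGraph) :
    ∃ (Y : FatDelta) (g : X ⟶ Y), Covering g ∧
      ∀ e, (pathAt φ e).edges.length = (pathAt (pathHom.{u} g) e).edges.length := by
  -- The covering morphism sends a vertex to the sum of the path lengths before it; the default
  -- value `0` never enters these sums.
  let ℓ : ℕ → ℕ := fun i => if h : i < X.dom.len then (pathAt φ ⟨i, h⟩).edges.length else 0
  have hℓ : ∀ e : Fin X.dom.len, ℓ e.val = (pathAt φ e).edges.length :=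
    fun e => dif_pos e.isLt
  obtain ⟨Y, g, hg, hgt⟩ := exists_covering X (fun j => ∑ i ∈ Finset.range j.val, ℓ i)
    (Fin.strictMono_iff_lt_succ.2 fun e => by
      simp only [Fin.val_castSucc, Fin.val_succ, Finset.sum_range_succ]
      have h₁ := hℓ e
      have h₂ := (pathAt φ e).length_edges_pos
      omega) (by simp)
  refine ⟨Y, g, hg, fun e => ?_⟩
  have h := add_length_pathAt_pathHom.{u} g e
  rw [hgt, hgt, Fin.val_castSucc, Fin.val_succ, Finset.sum_range_succ, hℓ] at h
  omega

/-- Composing with a graph morphism preserves path lengths, so `pathHom g'` has the lengths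
prescribed by `g` and factors through it. -/
theorem Covering.exists_factor {X Y Y' : FatDelta} {Z : RelGraph.{u}} {g : X ⟶ Y} (hg : Covering g)
    {x : Y.graph ⟶ Z} (g' : X ⟶ Y') {x' : Y'.graph ⟶ Z}
    (h : mapPath (pathHom g') x' = mapPath (pathHom g) x) :
    ∃ f : Y.graph ⟶ Y'.graph, mapPath (pathHom g) f = pathHom g' ∧ f ≫ x' = x := by
  obtain ⟨f, hf⟩ := hg.exists_map (φ := pathHom.{u} g') fun e => by
    rw [← length_pathAt_mapPath _ x, ← h, length_pathAt_mapPath]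
  exact ⟨f, hf, hg.map_unique (by rw [mapPath_comp, hf, h])⟩

theorem top_comp_of_mapPath_eq {X Y Y' : FatDelta} {g : X ⟶ Y} {g' : X ⟶ Y'}
    {f : Y.graph.{u} ⟶ Y'.graph} (h : mapPath (pathHom g) f = pathHom g')
    (i : Fin (X.dom.len + 1)) :
    f.onV (Y.vertex (g.top.toOrderHom i)) = Y'.vertex (g'.top.toOrderHom i) := by
  rw [← vertexAt_pathHom, ← vertexAt_pathHom, ← h, vertexAt_mapPath]

/-- Every morphism from a linear graph to the paths of `Z` factors through a covering morphism,
and this factorisation is initial. -/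
theorem exists_initial_factorization {X : Inert} {Z : RelGraph.{u}}
    (q : relSemiCatMonad.free.obj (toRelGraph.obj X) ⟶ relSemiCatMonad.free.obj Z) :
    ∃ (Y : Inert) (g : X.obj ⟶ Y.obj) (x : toRelGraph.obj Y ⟶ Z),
      (lift g).hom ≫ relSemiCatMonad.free.map x = q ∧
      ∀ (Y' : Inert) (g' : X.obj ⟶ Y'.obj) (x' : toRelGraph.obj Y' ⟶ Z),
        (lift g').hom ≫ relSemiCatMonad.free.map x' = q →
          ∃ f : Y ⟶ Y', g ≫ f.hom = g' ∧ toRelGraph.map f ≫ x' = x := by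
  obtain ⟨Y, g, hg, hlen⟩ := exists_covering_length (X := X.obj) (kleisli q)
  obtain ⟨x, hx⟩ := hg.exists_map hlen
  refine ⟨⟨Y⟩, g, x, (kleisli_bijective _ _).1 hx, fun Y' g' x' h => ?_⟩
  obtain ⟨f₀, hf₀, hx₀⟩ := hg.exists_factor (Y' := Y'.obj) (x := x) g' (x' := x')
    (Eq.trans (congrArg kleisli h) hx.symm)
  obtain ⟨f, rfl⟩ := exists_inert (X := ⟨Y⟩) f₀
  exact ⟨f, hom_ext fun i => congrArg ULift.down (top_comp_of_mapPath_eq hf₀ i), hx₀⟩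

end FatDelta

/-! ### Theories with arities from initial factorisations -/

universe w

/-- `(Q, α)` is a left Kan extension of `P` along `j` when every element of `Q` is represented by an
element of `P`, in an initial way. -/
theorem isLeftKanExtension_of_initial_factorizations {A : Type u₁} [Category.{v₁} A] {Θ : Type u₂}
    [Category.{v₂} Θ] (j : A ⥤ Θ) {P : Aᵒᵖ ⥤ Type w} {Q : Θᵒᵖ ⥤ Type w} (α : P ⟶ j.op ⋙ Q)
    (H : ∀ (θ : Θ) (q : Q.obj (op θ)), ∃ (a : A) (g : θ ⟶ j.obj a) (x : P.obj (op a)),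
      Q.map g.op (α.app (op a) x) = q ∧
      ∀ (a' : A) (g' : θ ⟶ j.obj a') (x' : P.obj (op a')), Q.map g'.op (α.app (op a') x') = q →
        ∃ f : a ⟶ a', g ≫ j.map f = g' ∧ P.map f.op x' = x) :
    Q.IsLeftKanExtension α := by
  choose a g x hq hf using H
  -- Any representative of `q` yields the same element of `R` as the chosen initial one. Naturality
  -- of `d` and the triangle identity both follow.
  have key : ∀ (R : Θᵒᵖ ⥤ Type w) (β : P ⟶ j.op ⋙ R) (θ : Θ) (q : Q.obj (op θ)) (a' : A)
      (g' : θ ⟶ j.obj a') (x' : P.obj (op a')), Q.map g'.op (α.app (op a') x') = q →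
      R.map (g θ q).op (β.app _ (x θ q)) = R.map g'.op (β.app (op a') x') := by
    intro R β θ q a' g' x' h
    obtain ⟨f, h₁, h₂⟩ := hf θ q a' g' x' h
    have hn := ConcreteCategory.congr_hom (β.naturality f.op) x'
    rw [← h₂, ← h₁, op_comp, R.map_comp]
    exact congrArg (R.map (g θ q).op) hn
  -- The only possible value: `q` is the restriction along `g` of `α x`, and `α x` has to go to `β
  -- x`.
  let d : ∀ (R : Θᵒᵖ ⥤ Type w) (_ : P ⟶ j.op ⋙ R), Q ⟶ R := fun R β =>
    { app := fun θ => TypeCat.ofHom fun q =>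
        R.map (g θ.unop q).op (β.app _ (x θ.unop q))
      naturality := fun θ θ' k => by
        ext q
        change R.map (g θ'.unop (Q.map k q)).op (β.app _ (x θ'.unop (Q.map k q))) =
          R.map k (R.map (g θ.unop q).op (β.app _ (x θ.unop q)))
        rw [key R β θ'.unop (Q.map k q) (a θ.unop q) (k.unop ≫ g θ.unop q) (x θ.unop q) (by
          rw [op_comp, Q.map_comp]
          exact congrArg (Q.map k) (hq θ.unop q)), op_comp, R.map_comp]
        rfl }
  refine ⟨⟨IsInitial.ofUniqueHom (fun t => StructuredArrow.homMk (d t.right t.hom) ?_)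
    fun t m => ?_⟩⟩
  · ext θ y
    refine Eq.trans (key t.right t.hom (j.obj θ.unop) (α.app θ y) θ.unop (𝟙 _) y ?_) ?_
    · rw [op_id, Q.map_id]
      rfl
    · rw [op_id, t.right.map_id]
      rfl
  · refine StructuredArrow.hom_ext _ _ ?_
    ext θ q
    change m.right.app θ q = t.right.map (g θ.unop q).op (t.hom.app _ (x θ.unop q))
    have hm := congrArg (fun (k : P ⟶ j.op ⋙ t.right) => k.app (op (a θ.unop q)) (x θ.unop q))
      (StructuredArrow.w m)
    have hn := ConcreteCategory.congr_hom (m.right.naturality (g θ.unop q).op)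
      (α.app _ (x θ.unop q))
    rw [← hm]
    refine Eq.trans ?_ hn
    exact congrArg (m.right.app θ) (hq θ.unop q).symm

/-- The nerve of the underlying object of a free algebra. -/
def nerveFreeIso {A : Type u₁} [Category.{v₁} A] {E : Type u₂} [Category.{v₂} E] (T : Monad E)
    (i : A ⥤ E) (Z : E) :
    (nerveAlong i).obj (T.forget.obj (T.free.obj Z)) ≅
      (MonadTheory.j T i).op ⋙ (inducedFunctor _).op ⋙ yoneda.obj (T.free.obj Z) :=
  NatIso.ofComponents
    (fun a => (T.adj.homEquiv (i.obj a.unop) (T.free.obj Z)).symm.toIso)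
    fun {a b} f => by
      ext h
      exact T.adj.homEquiv_naturality_left_symm (i.map f.unop) h

/-- The extension of the nerve of `Z` is `Hom(Ψ -, F Z)`, whose restriction along `j` is the nerve
of `T Z` by the free-forgetful adjunction. Allowing a fully faithful `Ψ` treats the theory of the
monad and fat Delta at once. -/
theorem isTheoryWithArities_of_initial_factorizations {A : Type u₁} [Category.{v₁} A]
    {E : Type u₂} [Category.{v₂} E] {Θ : Type u₃} [Category.{v₃} Θ] (T : Monad E) (i : A ⥤ E)
    (j : A ⥤ Θ) (Ψ : Θ ⥤ MonadTheory T i) [Ψ.Full] [Ψ.Faithful]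
    (e : j ⋙ Ψ ≅ MonadTheory.j T i) (hi : IsDenseGenerator i) (hj : Function.Bijective j.obj)
    (H : ∀ (X : A) (Z : E) (q : T.free.obj (i.obj X) ⟶ T.free.obj Z),
      ∃ (Y : A) (g : T.free.obj (i.obj X) ⟶ T.free.obj (i.obj Y)) (x : i.obj Y ⟶ Z),
        g ≫ T.free.map x = q ∧
        ∀ (Y' : A) (g' : T.free.obj (i.obj X) ⟶ T.free.obj (i.obj Y')) (x' : i.obj Y' ⟶ Z),
          g' ≫ T.free.map x' = q →
            ∃ f : Y ⟶ Y', g ≫ T.free.map (i.map f) = g' ∧ i.map f ≫ x' = x) :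
    IsTheoryWithArities i j where
  dense := hi
  bijective_obj := hj
  preserves P hP := by
    obtain ⟨Z, ⟨φ⟩⟩ := hP
    let Q₀ : (MonadTheory T i)ᵒᵖ ⥤ Type v₂ := (inducedFunctor _).op ⋙ yoneda.obj (T.free.obj Z)
    let Q : Θᵒᵖ ⥤ Type v₂ := Ψ.op ⋙ Q₀
    let α : (nerveAlong i).obj Z ⟶ j.op ⋙ Q :=
      { app := fun a => TypeCat.ofHom fun (x : i.obj a.unop ⟶ Z) =>
          (e.hom.app a.unop).hom ≫ T.free.map x
        naturality := fun a b f => by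
          ext (x : i.obj a.unop ⟶ Z)
          have hn := congrArg InducedCategory.Hom.hom (e.hom.naturality f.unop)
          change (e.hom.app b.unop).hom ≫ T.free.map (i.map f.unop ≫ x) =
            (Ψ.map (j.map f.unop)).hom ≫ (e.hom.app a.unop).hom ≫ T.free.map x
          rw [T.free.map_comp, ← Category.assoc, ← Category.assoc]
          exact congrArg (· ≫ T.free.map x) hn.symm }
    have hα : Q.IsLeftKanExtension α := by
      refine isLeftKanExtension_of_initial_factorizations j α fun θ q => ?_
      obtain ⟨Y, g, x, hq, hf⟩ := H (Ψ.obj θ) Z q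
      have hinv : ∀ Y, (e.inv.app Y).hom ≫ (e.hom.app Y).hom = 𝟙 _ := fun Y =>
        congrArg (fun k : (MonadTheory.j T i).obj Y ⟶ (MonadTheory.j T i).obj Y => k.hom)
          (e.inv_hom_id_app Y)
      have hinv' : ∀ Y, (e.hom.app Y).hom ≫ (e.inv.app Y).hom = 𝟙 _ := fun Y =>
        congrArg (fun k : (j ⋙ Ψ).obj Y ⟶ (j ⋙ Ψ).obj Y => k.hom) (e.hom_inv_id_app Y)
      let g₀ : Ψ.obj θ ⟶ (MonadTheory.j T i).obj Y := InducedCategory.homMk g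
      refine ⟨Y, Ψ.preimage (g₀ ≫ e.inv.app Y), x, ?_, fun Y' g' x' h => ?_⟩
      · change (Ψ.map (Ψ.preimage (g₀ ≫ e.inv.app Y))).hom ≫ (e.hom.app Y).hom ≫
          T.free.map x = q
        rw [Ψ.map_preimage, ← hq]
        exact (Category.assoc _ _ _).trans (congrArg (g ≫ ·) ((Category.assoc _ _ _).symm.trans
          ((congrArg (· ≫ T.free.map x) (hinv Y)).trans (Category.id_comp _))))
      · have h' : ((Ψ.map g').hom ≫ (e.hom.app Y').hom) ≫ T.free.map x' = q :=
          (Category.assoc _ _ _).trans h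
        obtain ⟨f, h₁, h₂⟩ := hf Y' _ x' h'
        refine ⟨f, Ψ.map_injective ?_, h₂⟩
        rw [Ψ.map_comp, Ψ.map_preimage, Category.assoc]
        have hn : e.inv.app Y ≫ Ψ.map (j.map f) = (MonadTheory.j T i).map f ≫ e.inv.app Y' :=
          (e.inv.naturality f).symm
        rw [hn]
        refine InducedCategory.hom_ext ?_
        exact (Category.assoc _ _ _).symm.trans ((congrArg (· ≫ (e.inv.app Y').hom) h₁).trans
          ((Category.assoc _ _ _).trans ((congrArg ((Ψ.map g').hom ≫ ·) (hinv' Y')).trans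
            (Category.comp_id _))))
    refine ⟨Q, φ.inv ≫ α, ?_, T.forget.obj (T.free.obj Z), ⟨?_⟩⟩
    · refine (Functor.isLeftKanExtension_iff_of_iso₂ α (φ.inv ≫ α) φ (Iso.refl _) ?_).1 hα
      simp
    · exact nerveFreeIso T i Z ≪≫ Functor.isoWhiskerRight (NatIso.op e) Q₀

namespace FatDelta

open RelGraph RelSemiCat

/-! ### Density of the inert part of fat Delta -/

section Dense

variable {Z W : RelGraph.{u}}

theorem ofMarks_zero_hom_ext {s : Set (Fin 0)} {f g : (ofMarks 0 s).graph ⟶ Z}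
    (h : f.onV ((ofMarks 0 s).vertex 0) = g.onV ((ofMarks 0 s).vertex 0)) : f = g :=
  graph_hom_ext (fun i => by
    obtain rfl : i = 0 := Subsingleton.elim (α := Fin 1) i 0
    exact h) fun e => Fin.elim0 (show Fin 0 from e)

theorem ofMarks_one_hom_ext {s : Set (Fin 1)} {f g : (ofMarks 1 s).graph ⟶ Z}
    (h : f.onE ((ofMarks 1 s).edge (0 : Fin 1)) = g.onE ((ofMarks 1 s).edge (0 : Fin 1))) :
    f = g := by
  have hE : ∀ e, f.onE ((ofMarks 1 s).edge e) = g.onE ((ofMarks 1 s).edge e) := fun e => by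
    obtain rfl : e = (0 : Fin 1) := Subsingleton.elim (α := Fin 1) e 0
    exact h
  refine graph_hom_ext (fun i => ?_) hE
  obtain rfl | rfl := Fin.eq_zero_or_eq_succ (n := 1) i |>.imp_right fun ⟨k, hk⟩ =>
      (hk.trans (congrArg Fin.succ (Subsingleton.elim k (0 : Fin 1))) : i = Fin.succ (0 : Fin 1))
  · have h₁ := f.src_onE ((ofMarks 1 s).edge (0 : Fin 1))
    rw [h] at h₁
    exact h₁.symm.trans (g.src_onE _)
  · have h₁ := f.tgt_onE ((ofMarks 1 s).edge (0 : Fin 1))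
    rw [h] at h₁
    exact h₁.symm.trans (g.tgt_onE _)

theorem exists_ofVertex (v : Z.V) :
    ∃ x : (ofMarks 0 ∅).graph ⟶ Z, x.onV ((ofMarks 0 ∅).vertex 0) = v := by
  obtain ⟨x, hx, -⟩ := exists_graph_hom (X := ofMarks 0 ∅) (fun _ => v)
    (fun e => Fin.elim0 (show Fin 0 from e)) (fun e => Fin.elim0 (show Fin 0 from e)) (fun e => Fin.elim0 (show Fin 0 from e))
    (fun e => Fin.elim0 (show Fin 0 from e))
  exact ⟨x, hx 0⟩

/-- With `s = ∅` this probes arbitrary edges, with `s = Set.univ` the marked ones. -/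
theorem exists_ofEdge (s : Set (Fin 1)) (e : Z.E) (he : s.Nonempty → e ∈ Z.marked) :
    ∃ x : (ofMarks 1 s).graph ⟶ Z, x.onE ((ofMarks 1 s).edge (0 : Fin 1)) = e := by
  obtain ⟨x, -, hx⟩ := exists_graph_hom (X := ofMarks 1 s)
    (Fin.cases (n := 1) (motive := fun _ => Z.V) (Z.src e) fun _ => Z.tgt e)
    (fun _ => e) (fun k => by
      obtain rfl : k = (0 : Fin 1) := Subsingleton.elim (α := Fin 1) k 0
      rfl) (fun k => rfl) (fun k hk => he ⟨k, by rwa [markedEdges_ofMarks] at hk⟩)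
  exact ⟨x, hx _⟩

/-- Evaluating on the point and on the unmarked edge determines the morphism; the marked edge shows
that it preserves marks. -/
theorem exists_of_natural
    (ν : ∀ a : Inert, (a.obj.graph ⟶ Z) → (a.obj.graph ⟶ W))
    (hν : ∀ (a b : Inert) (k : a.obj.graph ⟶ b.obj.graph) (h : b.obj.graph ⟶ Z),
      ν a (k ≫ h) = k ≫ ν b h) :
    ∃ f : Z ⟶ W, ∀ (a : Inert) (h : a.obj.graph ⟶ Z), h ≫ f = ν a h := by
  choose pt hpt using exists_ofVertex (Z := Z)
  choose ed hed using fun e : Z.E => exists_ofEdge ∅ e fun h => absurd h Set.not_nonempty_empty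
  let V : Z.V → W.V := fun v => (ν ⟨ofMarks 0 ∅⟩ (pt v)).onV ((ofMarks 0 ∅).vertex 0)
  let E : Z.E → W.E := fun e => (ν ⟨ofMarks 1 ∅⟩ (ed e)).onE ((ofMarks 1 ∅).edge (0 : Fin 1))
  have hV : ∀ (a : Inert) (h : a.obj.graph ⟶ Z) (v : a.obj.graph.V),
      V (h.onV v) = (ν a h).onV v := by
    intro a h v
    obtain ⟨x, hx⟩ := exists_ofVertex v
    have hp : pt (h.onV v) = x ≫ h := ofMarks_zero_hom_ext (by
      rw [hpt, comp_onV, hx])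
    change (ν ⟨ofMarks 0 ∅⟩ (pt (h.onV v))).onV ((ofMarks 0 ∅).vertex 0) = _
    rw [hp, hν ⟨ofMarks 0 ∅⟩ a x h, comp_onV, hx]
  have hE : ∀ (a : Inert) (h : a.obj.graph ⟶ Z) (e : a.obj.graph.E),
      E (h.onE e) = (ν a h).onE e := by
    intro a h e
    obtain ⟨x, hx⟩ := exists_ofEdge ∅ e fun h => absurd h Set.not_nonempty_empty
    have hp : ed (h.onE e) = x ≫ h := ofMarks_one_hom_ext (by
      rw [hed, comp_onE, hx])
    change (ν ⟨ofMarks 1 ∅⟩ (ed (h.onE e))).onE ((ofMarks 1 ∅).edge (0 : Fin 1)) = _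
    rw [hp, hν ⟨ofMarks 1 ∅⟩ a x h, comp_onE, hx]
  refine ⟨{ onV := V, onE := E, src_onE := fun e => ?_, tgt_onE := fun e => ?_,
            marked_onE := fun e he => ?_ }, fun a h => RelGraph.hom_ext (hV a h) (hE a h)⟩
  · refine ((ν ⟨ofMarks 1 ∅⟩ (ed e)).src_onE ((ofMarks 1 ∅).edge (0 : Fin 1))).trans ?_
    refine (hV ⟨ofMarks 1 ∅⟩ (ed e) _).symm.trans (congrArg V ?_)
    exact ((ed e).src_onE _).symm.trans (congrArg Z.src (hed e))
  · refine ((ν ⟨ofMarks 1 ∅⟩ (ed e)).tgt_onE ((ofMarks 1 ∅).edge (0 : Fin 1))).trans ?_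
    refine (hV ⟨ofMarks 1 ∅⟩ (ed e) _).symm.trans (congrArg V ?_)
    exact ((ed e).tgt_onE _).symm.trans (congrArg Z.tgt (hed e))
  -- By `hE` the marked probe of `e` computes the same value `E e`, as the image of a marked edge.
  · obtain ⟨x, hx⟩ := exists_ofEdge Set.univ e fun _ => he
    rw [← hx, hE ⟨ofMarks 1 Set.univ⟩ x]
    refine (ν ⟨ofMarks 1 Set.univ⟩ x).marked_onE _ (edge_mem_marked.2 ?_)
    rw [markedEdges_ofMarks]
    trivial

theorem isDenseGenerator_toRelGraph : IsDenseGenerator toRelGraph.{u} where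
  full := inferInstance
  faithful := inferInstance
  nerve_full := ⟨fun {Z W} η => by
    obtain ⟨f, hf⟩ := exists_of_natural (Z := Z) (W := W) (fun a h => η.app (op a) h)
      fun a b k h => by
        obtain ⟨k, rfl⟩ := exists_inert k
        exact ConcreteCategory.congr_hom (η.naturality k.op) h
    refine ⟨f, ?_⟩
    ext a h
    exact hf a.unop h⟩
  nerve_faithful := ⟨fun {Z W f g} h => by
    have key : ∀ (a : Inert) (x : a.obj.graph ⟶ Z), x ≫ f = x ≫ g := fun a x =>
      ConcreteCategory.congr_hom (NatTrans.congr_app h (op a)) x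
    refine RelGraph.hom_ext (fun v => ?_) fun e => ?_
    · obtain ⟨x, rfl⟩ := exists_ofVertex v
      exact congrArg (fun k : (ofMarks 0 ∅).graph ⟶ W => k.onV _) (key ⟨ofMarks 0 ∅⟩ x)
    · obtain ⟨x, rfl⟩ := exists_ofEdge ∅ e fun h => absurd h Set.not_nonempty_empty
      exact congrArg (fun k : (ofMarks 1 ∅).graph ⟶ W => k.onE _) (key ⟨ofMarks 1 ∅⟩ x)⟩

end Dense

/-! ### The two theories with arities. -/

instance : ofFatDelta.{u}.Full :=
  ⟨fun {_ _} h => ⟨toFatDelta.map h, lift_toFatDelta_map h⟩⟩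

instance : ofFatDelta.{u}.Faithful :=
  ⟨fun {X Y f g} h => by
    have := congrArg (fun k : theoryObj.{u} X ⟶ theoryObj Y => toFatDelta.map k) h
    exact (toFatDelta_map_lift f).symm.trans (this.trans (toFatDelta_map_lift g))⟩

theorem inertInclusion_comp_ofFatDelta :
    inertInclusion ⋙ ofFatDelta.{u} = MonadTheory.j relSemiCatMonad.{u} toRelGraph.{u} :=
  CategoryTheory.Functor.hext (fun _ => rfl) fun _ _ f => heq_of_eq (lift_inert f)

theorem exists_initial_factorization_free (X : Inert) (Z : RelGraph.{u})
    (q : relSemiCatMonad.free.obj (toRelGraph.obj X) ⟶ relSemiCatMonad.free.obj Z) :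
    ∃ (Y : Inert) (g : relSemiCatMonad.free.obj (toRelGraph.obj X) ⟶
        relSemiCatMonad.free.obj (toRelGraph.obj Y)) (x : toRelGraph.obj Y ⟶ Z),
      g ≫ relSemiCatMonad.free.map x = q ∧
      ∀ (Y' : Inert) (g' : relSemiCatMonad.free.obj (toRelGraph.obj X) ⟶
          relSemiCatMonad.free.obj (toRelGraph.obj Y')) (x' : toRelGraph.obj Y' ⟶ Z),
        g' ≫ relSemiCatMonad.free.map x' = q →
          ∃ f : Y ⟶ Y', g ≫ relSemiCatMonad.free.map (toRelGraph.map f) = g' ∧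
            toRelGraph.map f ≫ x' = x := by
  obtain ⟨Y, g, x, hq, hf⟩ := exists_initial_factorization q
  refine ⟨Y, (lift g).hom, x, hq, fun Y' g' x' h => ?_⟩
  obtain ⟨k, rfl⟩ : ∃ k : X.obj ⟶ Y'.obj, (lift k).hom = g' :=
    ⟨_, congrArg (fun k : theoryObj.{u} X.obj ⟶ theoryObj Y'.obj => k.hom)
      (lift_toFatDelta_map (InducedCategory.homMk g'))⟩
  obtain ⟨f, rfl, h₂⟩ := hf Y' k x' h
  exact ⟨f, congrArg (fun k : theoryObj.{u} X.obj ⟶ theoryObj Y'.obj => k.hom)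
    ((lift_comp g f.hom).trans (congrArg (lift g ≫ ·) (lift_inert f))).symm, h₂⟩

theorem isTheoryWithArities_j :
    IsTheoryWithArities toRelGraph.{u} (MonadTheory.j relSemiCatMonad.{u} toRelGraph.{u}) :=
  isTheoryWithArities_of_initial_factorizations _ _ _ (𝟭 _) (Functor.rightUnitor _)
    isDenseGenerator_toRelGraph Function.bijective_id exists_initial_factorization_free

theorem isTheoryWithArities_inertInclusion :
    IsTheoryWithArities toRelGraph.{u} inertInclusion :=
  isTheoryWithArities_of_initial_factorizations _ _ _ ofFatDelta
    (eqToIso inertInclusion_comp_ofFatDelta) isDenseGenerator_toRelGraph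
    bijective_inertInclusion_obj exists_initial_factorization_free

end FatDelta

/-! ### Canonical arities -/

/-- A finite sequence of truth values decomposes into maximal constant blocks. -/
theorem Nat.exists_alternating_blocks (s : ℕ → Prop) (n : ℕ) :
    ∃ (m : ℕ) (t : ℕ → ℕ) (a : ℕ → Prop), t 0 = 0 ∧ t m = n ∧ (∀ i ≤ m, t i ≤ n) ∧
      (∀ e < m, t e < t (e + 1)) ∧
      (∀ e < m, ∀ k, t e ≤ k → k < t (e + 1) → (s k ↔ a e)) ∧
      ∀ e, e + 1 < m → (a e ↔ ¬ a (e + 1)) := by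
  induction n with
  | zero => exact ⟨0, fun _ => 0, fun _ => True, by simp⟩
  | succ n ih =>
    obtain ⟨m, t, a, h0, hm, hle, hlt, hs, ha⟩ := ih
    -- Either the new value prolongs the last block, or it opens a block of length one.
    by_cases hext : 0 < m ∧ (s n ↔ a (m - 1))
    · obtain ⟨hpos, hsn⟩ := hext
      have ht : ∀ i, i < m → Function.update t m (n + 1) i = t i := fun i hi =>
        Function.update_of_ne hi.ne _ _
      have htm : Function.update t m (n + 1) m = n + 1 := Function.update_self _ _ _
      refine ⟨m, Function.update t m (n + 1), a, by rw [ht 0 hpos, h0], htm, fun i hi => ?_,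
        fun e he => ?_, fun e he k => ?_, ha⟩
      · rcases hi.eq_or_lt with rfl | hi'
        · exact htm.le
        · rw [ht i hi']
          exact (hle i hi).trans (Nat.le_succ n)
      · rw [ht e he]
        rcases (Nat.succ_le_of_lt he).eq_or_lt with h | h
        · rw [Nat.succ_eq_add_one] at h
          rw [h, htm]
          exact Nat.lt_succ_of_le (hle e he.le)
        · rw [ht (e + 1) h]
          exact hlt e he
      · rw [ht e he]
        rcases (Nat.succ_le_of_lt he).eq_or_lt with h | h
        · rw [Nat.succ_eq_add_one] at h
          rw [h, htm]
          intro h₁ h₂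
          rcases (Nat.le_of_lt_succ h₂).eq_or_lt with rfl | h₃
          · rw [hsn, ← h, Nat.add_sub_cancel]
          · exact hs e he k h₁ (by rw [h, hm]; exact h₃)
        · rw [ht (e + 1) h]
          exact hs e he k
    · have ht : ∀ i, i ≤ m → Function.update t (m + 1) (n + 1) i = t i := fun i hi =>
        Function.update_of_ne (Nat.lt_succ_of_le hi).ne _ _
      have htm : Function.update t (m + 1) (n + 1) (m + 1) = n + 1 := Function.update_self _ _ _
      have hta : ∀ e, e < m → Function.update a m (s n) e = a e := fun i hi =>
        Function.update_of_ne hi.ne _ _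
      have htam : Function.update a m (s n) m = s n := Function.update_self _ _ _
      refine ⟨m + 1, Function.update t (m + 1) (n + 1), Function.update a m (s n),
        by rw [ht 0 (Nat.zero_le _), h0], htm, fun i hi => ?_, fun e he => ?_, fun e he k => ?_,
        fun e he => ?_⟩
      · rcases hi.eq_or_lt with rfl | hi'
        · exact htm.le
        · rw [ht i (Nat.le_of_lt_succ hi')]
          exact (hle i (Nat.le_of_lt_succ hi')).trans (Nat.le_succ n)
      · rw [ht e (Nat.le_of_lt_succ he)]
        rcases (Nat.le_of_lt_succ he).eq_or_lt with rfl | h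
        · rw [htm, hm]
          exact Nat.lt_succ_self n
        · rw [ht (e + 1) h]
          exact hlt e h
      · rw [ht e (Nat.le_of_lt_succ he)]
        rcases (Nat.le_of_lt_succ he).eq_or_lt with rfl | h
        · rw [htm, hm, htam]
          intro h₁ h₂
          rw [le_antisymm (Nat.le_of_lt_succ h₂) h₁]
        · rw [ht (e + 1) h, hta e h]
          exact hs e h k
      · have he' : e < m := Nat.lt_of_succ_lt_succ he
        rw [hta e he']
        rcases (Nat.succ_le_of_lt he').eq_or_lt with h | h
        · rw [Nat.succ_eq_add_one] at h
          rw [h, htam]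
          -- There is a last block here, with index `e`, so the failure of `hext` means that the
          -- value changes.
          have : ¬ (s n ↔ a e) := fun h' => hext ⟨by omega, by
            rw [← h, Nat.add_sub_cancel]
            exact h'⟩
          tauto
        · rw [hta (e + 1) h]
          exact ha e h

namespace FatDelta

open RelGraph RelSemiCat

theorem graph_ofMarks (n : ℕ) (s : Set (Fin n)) : (ofMarks n s).graph = linear.{u} n s :=
  congrArg (linear.{u} n) (markedEdges_ofMarks n s)

/-- Contract each maximal run of equally marked edges of `Y` to one edge with the same marking; by
maximality adjacent runs differ. -/
theorem exists_alternating_covering (Y : FatDelta) :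
    ∃ (X : FatDelta) (g : X ⟶ Y), alternating.{u} X.graph ∧ Covering g := by
  obtain ⟨m, t, a, h0, hm, hle, hlt, hs, ha⟩ := Nat.exists_alternating_blocks
    (fun k => ∃ h : k < Y.dom.len, (⟨k, h⟩ : Fin Y.dom.len) ∈ Y.markedEdges) Y.dom.len
  let t' : Fin (m + 1) → Fin (Y.dom.len + 1) := fun i =>
    ⟨t i, Nat.lt_succ_of_le (hle i (Nat.le_of_lt_succ i.isLt))⟩
  have h0' : t' 0 = 0 := Fin.ext h0
  have hl' : t' (Fin.last m) = Fin.last _ := Fin.ext hm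
  have ht' : StrictMono t' := Fin.strictMono_iff_lt_succ.2 fun e => hlt e e.isLt
  obtain ⟨g, hg⟩ := exists_hom (X := ofMarks m {e | a e}) (Y := Y) t' ht' (by
    intro e he
    rw [markedEdges_ofMarks] at he
    refine Fin.eq_of_adjacent (f := fun k => Y.η.toOrderHom k)
      (ht'.monotone (Fin.castSucc_lt_succ).le) fun k h₁ h₂ => ?_
    exact ((hs e.val e.isLt k.val h₁ h₂).2 he).2)
  refine ⟨ofMarks m {e | a e}, g, ⟨m, {e | a e}, fun i j hij => ?_, graph_ofMarks _ _⟩,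
    ⟨(hg 0).trans h0', (hg _).trans hl', fun k hk => ?_⟩⟩
  · have h := ha i.val (by
      rw [← hij]
      exact j.isLt)
    rw [← hij] at h
    exact h
  · obtain ⟨e, h₁, h₂⟩ := Fin.exists_block t' h0' hl' k
    refine ⟨e, ?_, (hg _).trans_le h₁, h₂.trans (hg _).ge⟩
    rw [markedEdges_ofMarks]
    exact (hs e.val e.isLt k.val h₁ h₂).1 ⟨k.isLt, hk⟩

/-- The composite of a morphism of fat Delta, seen as a morphism from `X` to the paths of `Y`, with
the morphism to the paths of the terminal relative graph. -/
noncomputable def lengthHom {X Y : FatDelta} (g : X ⟶ Y) :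
    X.graph ⟶ relSemiCatMonad.{u}.toFunctor.obj one :=
  mapPath (pathHom.{u} g) (isTerminalOne.from Y.graph)

/-- A morphism `g` of fat Delta as an arrow under `lengthHom g`. -/
noncomputable def pathArrow {X Y : FatDelta} (g : X ⟶ Y) :
    StructuredArrow (Over.mk (lengthHom.{u} g))
      (toOverTerminal relSemiCatMonad.{u}.toFunctor isTerminalOne.{u}) :=
  StructuredArrow.mk (Y := Y.graph) (Over.homMk (pathHom g) rfl)

/-- A map to the paths of some `Z` lies over `lengthHom g` only if its paths have the lengths
prescribed by `g`, so the universal property of covering morphisms applies. -/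
theorem Covering.nonempty_isInitial {X Y : FatDelta} {g : X ⟶ Y} (hg : Covering g) :
    Nonempty (IsInitial (pathArrow.{u} g)) := by
  have key : ∀ t : StructuredArrow (Over.mk (lengthHom.{u} g))
      (toOverTerminal relSemiCatMonad.{u}.toFunctor isTerminalOne.{u}),
      ∃ x : Y.graph ⟶ t.right, mapPath (pathHom g) x = t.hom.left := by
    intro t
    have hw : mapPath (A := X.graph) (Z := t.right) t.hom.left (isTerminalOne.from t.right) =
        mapPath (pathHom.{u} g) (isTerminalOne.from Y.graph) := Over.w t.hom
    refine hg.exists_map (φ := t.hom.left) fun e => ?_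
    have h := congrArg
      (fun k : X.graph ⟶ (pathSemiCat one).toRelGraph => (pathAt k e).edges.length) hw
    exact (length_pathAt_mapPath _ _ e).symm.trans (h.trans (length_pathAt_mapPath _ _ e))
  choose x hx using key
  refine ⟨IsInitial.ofUniqueHom (fun t => StructuredArrow.homMk (x t) ?_) fun t k => ?_⟩
  · exact Over.OverMorphism.ext (hx t)
  · have hw : mapPath (pathHom g) k.right = t.hom.left :=
      congrArg (fun q : Over.mk (lengthHom.{u} g) ⟶
        (toOverTerminal relSemiCatMonad.{u}.toFunctor isTerminalOne.{u}).obj t.right => q.left)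
        (StructuredArrow.w k)
    exact StructuredArrow.hom_ext _ _ (hg.map_unique (hw.trans (hx t).symm))

theorem canonicalArities_iff (G : RelGraph.{u}) :
    canonicalArities relSemiCatMonad.{u}.toFunctor isTerminalOne.{u} alternating.{u} G ↔
      toRelGraph.{u}.essImage G := by
  constructor
  · rintro ⟨A, ⟨n, s, -, rfl⟩, p, L, ⟨hL⟩, ⟨φ⟩⟩
    -- The two graphs are only propositionally equal, hence the generalisation before substituting.
    obtain ⟨X, hX⟩ : ∃ X : FatDelta, X.graph = linear.{u} n s := ⟨_, graph_ofMarks n s⟩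
    generalize linear.{u} n s = A at hX p L hL φ
    subst hX
    obtain ⟨Y, g, hg, hlen⟩ := exists_covering_length (Z := one.{u}) p
    -- A path in the terminal graph is determined by its length.
    have hp : p = lengthHom g :=
      pathAt_ext (fun _ => rfl) fun e => List.ext_getElem
        ((hlen e).trans (length_pathAt_mapPath (pathHom g) (isTerminalOne.from Y.graph) e).symm)
        fun _ _ _ => rfl
    subst hp
    obtain ⟨h⟩ := hg.nonempty_isInitial
    exact ⟨⟨Y⟩, ⟨(StructuredArrow.proj (Over.mk (lengthHom.{u} g))
      (toOverTerminal relSemiCatMonad.{u}.toFunctor isTerminalOne.{u})).mapIso (h.uniqueUpToIso hL) ≪≫ φ⟩⟩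
  · rintro ⟨Y, ⟨φ⟩⟩
    obtain ⟨X, g, hX, hg⟩ := exists_alternating_covering.{u} Y.obj
    exact ⟨X.graph, hX, _, pathArrow g, hg.nonempty_isInitial, ⟨φ⟩⟩

/-! ### Homogeneity of the theory of the monad -/

theorem genericMorphisms_toFatDelta_iff {X Y : Theory.{u}} (g : X ⟶ Y) :
    genericMorphisms (MonadTheory.j relSemiCatMonad.{u} toRelGraph.{u}) g ↔
      genericMorphisms inertInclusion (toFatDelta.map g) := by
  refine (genericMorphisms_obj_iff (j := MonadTheory.j relSemiCatMonad.{u} toRelGraph.{u})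
    Function.injective_id (b := Y) g).trans (Iff.trans ?_
      (genericMorphisms_obj_iff bijective_inertInclusion_obj.1 (b := Y) (toFatDelta.map g)).symm)
  constructor
  · intro h a f g' hg
    refine h a f (lift g') ((toFatDelta_map_bijective X Y).1 ?_)
    exact (toFatDelta.map_comp _ _).trans ((congrArg₂ (· ≫ ·) (toFatDelta_map_lift.{u} g')
      (toFatDelta_map_j.{u} f)).trans hg)
  · intro h a f g' hg
    refine h a f (toFatDelta.map g') ?_
    rw [← hg]
    exact (congrArg (toFatDelta.map g' ≫ ·) (toFatDelta_map_j.{u} f).symm).trans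
      (toFatDelta.map_comp _ _).symm

theorem freeMorphisms_toFatDelta_iff {X Y : Theory.{u}} (g : X ⟶ Y) :
    freeMorphisms (MonadTheory.j relSemiCatMonad.{u} toRelGraph.{u}) g ↔
      freeMorphisms inertInclusion (toFatDelta.map g) := by
  refine Iff.trans ?_ (freeMorphisms_iff (toFatDelta.map g)).symm
  constructor
  · rintro ⟨_⟩
    rename_i X Y f _
    exact @Eq.subst _ (fun k : X.obj ⟶ Y.obj => inert k) _ _ (toFatDelta_map_j.{u} f).symm
      f.property
  · intro h
    let f : (show Inert from X) ⟶ (show Inert from Y) := ⟨toFatDelta.map g, h⟩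
    have hf : (MonadTheory.j relSemiCatMonad.{u} toRelGraph.{u}).map f = g :=
      (lift_inert f).symm.trans (lift_toFatDelta_map g)
    rw [← hf]
    exact MorphismProperty.map_mem_strictMap _ _ f trivial

end FatDelta

/-- Used to carry the factorisation system on fat Delta over to the theory of the monad along
`toFatDelta`. -/
theorem IsOrthogonalFactorizationSystem.inverseImage {C : Type u₁} [Category.{v₁} C] {D : Type u₂}
    [Category.{v₂} D] {L R : MorphismProperty D} (h : IsOrthogonalFactorizationSystem L R)
    (F : C ⥤ D) [F.Full] [F.Faithful] (hF : Function.Surjective F.obj) :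
    IsOrthogonalFactorizationSystem (L.inverseImage F) (R.inverseImage F) where
  isos_le_left X Y f hf := by
    have : IsIso f := hf
    exact h.isos_le_left _ (inferInstanceAs (IsIso (F.map f)))
  isos_le_right X Y f hf := by
    have : IsIso f := hf
    exact h.isos_le_right _ (inferInstanceAs (IsIso (F.map f)))
  comp_left := ⟨fun f g hf hg => by
    have := h.comp_left
    change L (F.map (f ≫ g))
    rw [F.map_comp]
    exact L.comp_mem _ _ hf hg⟩
  comp_right := ⟨fun f g hf hg => by
    have := h.comp_right
    change R (F.map (f ≫ g))
    rw [F.map_comp]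
    exact R.comp_mem _ _ hf hg⟩
  factorization f := by
    obtain ⟨Z, l, r, hl, hr, e⟩ := h.factorization (F.map f)
    obtain ⟨Z, rfl⟩ := hF Z
    refine ⟨Z, F.preimage l, F.preimage r, ?_, ?_, F.map_injective ?_⟩
    · simpa [MorphismProperty.inverseImage] using hl
    · simpa [MorphismProperty.inverseImage] using hr
    · simpa using e
  orthogonal l r s t hl hr e := by
    obtain ⟨d, ⟨h₁, h₂⟩, hd⟩ := h.orthogonal (F.map l) (F.map r) (F.map s) (F.map t) hl hr
      (by rw [← F.map_comp, e, F.map_comp])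
    refine ⟨F.preimage d, ⟨F.map_injective (by simpa using h₁), F.map_injective (by simpa using h₂)⟩,
      fun d' hd' => F.map_injective ?_⟩
    rw [F.map_preimage]
    exact hd _ ⟨by rw [← F.map_comp, hd'.1], by rw [← F.map_comp, hd'.2]⟩

namespace FatDelta

theorem isHomogeneousTheory_inertInclusion :
    IsHomogeneousTheory toRelGraph.{u} inertInclusion where
  theory := isTheoryWithArities_inertInclusion
  faithful := inferInstance
  genericFree := isOrthogonalFactorizationSystem

theorem isHomogeneousTheory_j :
    IsHomogeneousTheory toRelGraph.{u} (MonadTheory.j relSemiCatMonad.{u} toRelGraph.{u}) where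
  theory := isTheoryWithArities_j
  faithful := ⟨fun {X Y f g} h => WideSubcategory.hom_ext _
    ((toFatDelta_map_j.{u} f).symm.trans ((congrArg toFatDelta.map h).trans (toFatDelta_map_j.{u} g)))⟩
  genericFree := by
    have h := isOrthogonalFactorizationSystem.inverseImage toFatDelta.{u} fun X => ⟨theoryObj X, rfl⟩
    convert h using 1
    · ext X Y g
      exact genericMorphisms_toFatDelta_iff g
    · ext X Y g
      exact freeMorphisms_toFatDelta_iff g

end FatDelta

theorem theorem4p16 :
    -- the inert part of fat Delta is the category of canonical arities of the monad,
    -- relative to the alternatingly marked linear graphs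
    (∀ X : RelGraph.{u},
      canonicalArities relSemiCatMonad.{u}.toFunctor RelGraph.isTerminalOne.{u}
        RelGraph.alternating.{u} X ↔ FatDelta.toRelGraph.{u}.essImage X) ∧
    -- the theory associated with the monad is homogeneous
    IsHomogeneousTheory FatDelta.toRelGraph.{u}
      (MonadTheory.j relSemiCatMonad.{u} FatDelta.toRelGraph.{u}) ∧
    -- this theory is fat Delta, with the inclusion of its inert part
    (∃ (Φ : MonadTheory relSemiCatMonad.{u} FatDelta.toRelGraph.{u} ⥤ FatDelta)
      (Ψ : FatDelta ⥤ MonadTheory relSemiCatMonad.{u} FatDelta.toRelGraph.{u}),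
      Φ ⋙ Ψ = 𝟭 _ ∧ Ψ ⋙ Φ = 𝟭 _ ∧
      MonadTheory.j relSemiCatMonad.{u} FatDelta.toRelGraph.{u} ⋙ Φ =
        FatDelta.inertInclusion) ∧
    -- hence fat Delta is homogeneous; in particular its generic and free morphisms form an
    -- orthogonal factorisation system
    IsHomogeneousTheory FatDelta.toRelGraph.{u} FatDelta.inertInclusion ∧
    IsOrthogonalFactorizationSystem (genericMorphisms FatDelta.inertInclusion)
      (freeMorphisms FatDelta.inertInclusion) :=
  ⟨FatDelta.canonicalArities_iff, FatDelta.isHomogeneousTheory_j,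
    ⟨FatDelta.toFatDelta, FatDelta.ofFatDelta, FatDelta.toFatDelta_comp_ofFatDelta,
      FatDelta.ofFatDelta_comp_toFatDelta, FatDelta.j_comp_toFatDelta⟩,
    FatDelta.isHomogeneousTheory_inertInclusion, FatDelta.isOrthogonalFactorizationSystem⟩
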